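/- Let $m,n\ge 0$ be integers with $n$ even and $m-n\neq 4$, and let $L\ge 0$ be an integer (the number of particles). For $a\in\{1,\dots,m+n\}$ put $[a]=0$ if $a\le m$ and $[a]=1$ if $a>m$; $\xi_a=+1$ if $a\le m+\frac n2$ and $\xi_a=-1$ otherwise; $\bar a=m+1-a$ if $a\le m$ and $\bar a=2m+n+1-a$ if $a>m$; and $g_{ab}=\xi_a\delta_{a\bar b}$. Let $V$ be the complex $\mathbb Z_2$-graded vector space with homogeneous basis $v^1,\dots,v^{m+n}$, $v^a$ of degree $[a]$. On the graded tensor product $V^{\otimes L}$ let $e_j^{ab}$ be the operator $$e_j^{ab}\,(v^{p_1}\otimes\cdots\otimes v^{p_L})=(-1)^{([a]+[b])([p_1]+\cdots+[p_{j-1}])}\,\delta_{b p_j}\,v^{p_1}\otimes\cdots\otimes v^{p_{j-1}}\otimes v^{a}\otimes v^{p_{j+1}}\otimes\cdots\otimes v^{p_L},$$ and let $$\sigma_j^{ab}=\sum_{k=1}^{m+n}\left(g_{ak}e_j^{kb}-(-1)^{[a][b]}g_{bk}e_j^{ka}\right),\qquad (\sigma_j\sigma_k)^{ab}=\sum_{c=1}^{m+n}\xi_c\,\sigma_j^{ac}\sigma_k^{\bar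 c b}.$$ These act on the smooth $V^{\otimes L}$-valued functions on $\{(x_1,\dots,x_L)\in\mathbb R^L: x_j\neq x_k \text{ for } j\neq k\}$. For a complex number $\lambda$ define the operators $$J_0^{ab}=\sum_{j=1}^L\sigma_j^{ab},\qquad J_1^{ab}=\sum_{j=1}^L\sigma_j^{ab}\frac{\partial}{\partial x_j}-\lambda\sum_{j\ne k}(\sigma_j\sigma_k)^{ab}\frac{1}{x_j-x_k}$$ on these functions. Let $[\cdot,\cdot]$ be the graded commutator $[A,B]=AB-(-1)^{|A||B|}BA$, where $J_0^{ab}$ and $J_1^{ab}$ have parity $[a]+[b]$ and parities add under products. If $$\lambda=\frac{2}{m-n-4},$$ then for all $a,b,c,d,e,f\in\{1,\dots,m+n\}$: $$[J_0^{ab},J_0^{cd}]=g_{cb}J_0^{ad}-(-1)^{([a]+[b])([c]+[d])}g_{ad}J_0^{cb}-(-1)^{[c][d]}\left(g_{db}J_0^{ac}-(-1)^{([a]+[b])([c]+[d])}g_{ac}J_0^{db}\right),$$ $$[J_0^{ab},J_1^{cd}]=g_{cb}J_1^{ad}-(-1)^{([a]+[b])([c]+[d])}g_{ad}J_1^{cb}-(-1)^{[c][d]}\left(g_{db}J_1^{ac}-(-1)^{([a]+[b])([c]+[d])}g_{ac}J_1^{db}\right),$$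 $$(-1)^{([a]+[b])([c]+[d])}\left[J_1^{cd},[J_0^{ab},J_1^{ef}]\right]+\left[[J_0^{ab},J_1^{cd}],J_1^{ef}\right]-\left[J_1^{ab},[J_0^{cd},J_1^{ef}]\right]=0.$$ -/

import Mathlib

open scoped ContDiff

namespace OspCalogero

noncomputable section

/-! Indices `1, …, m + n` are represented by the elements `0, …, m + n - 1` of `Fin (m + n)`. -/

/-- The `ℤ₂`-grading `[a]`: the first `m` indices are even, the last `n` are odd. -/
def grade (m n : ℕ) (a : Fin (m + n)) : ℕ := if (a : ℕ) < m then 0 else 1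

/-- The sign `ξ_a`: `+1` on the first `m + n / 2` indices and `-1` on the others
(it is used for even `n`). -/
def xi (m n : ℕ) (a : Fin (m + n)) : ℂ := if (a : ℕ) < m + n / 2 then 1 else -1

/-- The conjugate index `ā`: it reverses the first `m` indices, and it reverses the last `n`. -/
def bar (m n : ℕ) (a : Fin (m + n)) : Fin (m + n) :=
  if h : (a : ℕ) < m then ⟨m - 1 - a, by omega⟩ else ⟨2 * m + n - 1 - a, by omega⟩

/-- The metric `g_{ab} = ξ_a δ_{a, b̄}`. -/
def metric (m n : ℕ) (a b : Fin (m + n)) : ℂ := if a = bar m n b then xi m n a else 0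

/-- The spin space `V ⊗ ⋯ ⊗ V` (`L` factors, `V` of dimension `m | n`), in coordinates: the basis
vector `Pi.single p 1` is `v^{p 0} ⊗ ⋯ ⊗ v^{p (L - 1)}`. -/
abbrev Spin (m n L : ℕ) : Type := (Fin L → Fin (m + n)) → ℂ

/-- The generator `e_j^{ab}` of `gl(m|n)` acting on the `j`-th tensor factor of the graded tensor
product: `e^{ab} v^c = δ_{bc} v^a` on that factor, and moving `e^{ab}` past the factors `i < j`
gives the sign `(-1)^{([a] + [b]) ∑_{i < j} [p i]}`. The action on basis vectors is
`siteE_single`. -/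
def siteE (m n L : ℕ) (j : Fin L) (a b : Fin (m + n)) : Spin m n L →ₗ[ℂ] Spin m n L where
  toFun ψ q :=
    if q j = a then
      (-1 : ℂ) ^ ((grade m n a + grade m n b) * ∑ i ∈ Finset.univ.filter (· < j), grade m n (q i))
        * ψ (Function.update q j b)
    else 0
  map_add' ψ φ := by
    funext q
    by_cases h : q j = a <;> simp [h, mul_add]
  map_smul' c ψ := by
    funext q
    by_cases h : q j = a <;> simp [h, mul_left_comm]

theorem siteE_single (m n L : ℕ) (j : Fin L) (a b : Fin (m + n)) (p : Fin L → Fin (m + n)) :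
    siteE m n L j a b (Pi.single p 1) =
      if p j = b then
        (-1 : ℂ) ^ ((grade m n a + grade m n b) *
            ∑ i ∈ Finset.univ.filter (· < j), grade m n (p i)) •
          (Pi.single (Function.update p j a) 1 : Spin m n L)
      else 0 := by
  funext q
  by_cases hq : q = Function.update p j a
  · subst hq
    have hs : ∑ i ∈ Finset.univ.filter (· < j), grade m n (Function.update p j a i) =
        ∑ i ∈ Finset.univ.filter (· < j), grade m n (p i) := by
      refine Finset.sum_congr rfl fun i hi => ?_
      rw [Function.update_of_ne (ne_of_lt (Finset.mem_filter.1 hi).2)]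
    by_cases hp : p j = b
    · have hu : Function.update p j b = p := by rw [← hp, Function.update_eq_self]
      simp [siteE, hs, hp, hu]
    · have hu : Function.update p j b ≠ p := fun h => hp (by rw [← h]; simp)
      simp [siteE, hp]
  · have h1 : ¬ (q j = a ∧ Function.update q j b = p) := by
      rintro ⟨h, h'⟩
      apply hq
      rw [← h', ← h]
      simp
    by_cases hp : p j = b
    · simp only [siteE, LinearMap.coe_mk, AddHom.coe_mk, hp, if_true, Pi.smul_apply,
        Pi.single_eq_of_ne hq, smul_zero]
      by_cases h : q j = a
      · rw [if_pos h, Pi.single_eq_of_ne (fun h' => h1 ⟨h, h'⟩), mul_zero]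
      · rw [if_neg h]
    · have hu : Function.update q j b ≠ p := fun h => hp (by rw [← h]; simp)
      simp [siteE, hp, Pi.single_eq_of_ne hu]

/-- The generators of `osp(m|n)` acting on the `j`-th factor:
`σ_j^{ab} = g_{ak} e_j^{kb} - (-1)^{[a][b]} g_{bk} e_j^{ka}`, summed over `k`. -/
def sigma (m n L : ℕ) (j : Fin L) (a b : Fin (m + n)) : Spin m n L →ₗ[ℂ] Spin m n L :=
  (∑ k, metric m n a k • siteE m n L j k b) -
    (-1 : ℂ) ^ (grade m n a * grade m n b) • ∑ k, metric m n b k • siteE m n L j k a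

/-- `(σ_j σ_k)^{ab} = ∑_c ξ_c σ_j^{ac} σ_k^{c̄ b}`. -/
def sigmaSigma (m n L : ℕ) (j k : Fin L) (a b : Fin (m + n)) : Spin m n L →ₗ[ℂ] Spin m n L :=
  ∑ c, xi m n c • (sigma m n L j a c ∘ₗ sigma m n L k (bar m n c) b)

/-- The configuration space of `L` distinct points `x_1, …, x_L` on the real line. -/
def config (L : ℕ) : Set (Fin L → ℝ) := {x | ∀ j k, j ≠ k → x j ≠ x k}

theorem isOpen_config (L : ℕ) : IsOpen (config L) := by
  have h : config L = ⋂ j : Fin L, ⋂ k : Fin L, {x : Fin L → ℝ | j ≠ k → x j ≠ x k} := by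
    ext x
    simp [config]
  rw [h]
  refine isOpen_iInter_of_finite fun j => isOpen_iInter_of_finite fun k => ?_
  by_cases hjk : j = k
  · simp [hjk]
  · simpa [hjk] using isOpen_ne_fun (continuous_apply j) (continuous_apply k)

/-- The complex vector space of smooth functions on the configuration space with values in the
spin space. A function on the configuration space is represented by its extension by zero. -/
def Wave (m n L : ℕ) : Submodule ℂ ((Fin L → ℝ) → Spin m n L) where
  carrier := {ψ | ContDiffOn ℝ ∞ ψ (config L) ∧ ∀ x ∉ config L, ψ x = 0}
  add_mem' := fun {ψ φ} hψ hφ =>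
    ⟨hψ.1.add hφ.1, fun x hx => by simp [hψ.2 x hx, hφ.2 x hx]⟩
  zero_mem' := ⟨contDiffOn_const, fun _ _ => rfl⟩
  smul_mem' := fun c ψ hψ => ⟨hψ.1.const_smul c, fun x hx => by simp [hψ.2 x hx]⟩

/-- A linear operator on the spin space, acting pointwise on wave functions. -/
def spinOp (m n L : ℕ) (A : Spin m n L →ₗ[ℂ] Spin m n L) : Module.End ℂ (Wave m n L) where
  toFun ψ := ⟨fun x => A (ψ.1 x), by
    refine ⟨?_, fun x hx => by simp [ψ.2.2 x hx]⟩
    exact (LinearMap.toContinuousLinearMap (A.restrictScalars ℝ)).contDiff.comp_contDiffOn ψ.2.1⟩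
  map_add' ψ φ := by
    ext1
    funext x
    exact map_add A _ _
  map_smul' c ψ := by
    ext1
    funext x
    exact map_smul A c _

/-- The operator `∂ / ∂ x_j` on wave functions. -/
def partialOp (m n L : ℕ) (j : Fin L) : Module.End ℂ (Wave m n L) where
  toFun ψ := ⟨(config L).indicator fun x => fderiv ℝ ψ.1 x (Pi.single j 1), by
    refine ⟨?_, fun x hx => Set.indicator_of_notMem hx _⟩
    have h : ContDiffOn ℝ ∞ (fun x => fderiv ℝ ψ.1 x (Pi.single j 1)) (config L) :=
      (ψ.2.1.fderiv_of_isOpen (isOpen_config L) le_rfl).clm_apply contDiffOn_const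
    exact h.congr fun x hx => Set.indicator_of_mem hx _⟩
  map_add' ψ φ := by
    ext1
    funext x
    by_cases hx : x ∈ config L
    · have hd : ∀ χ : Wave m n L, DifferentiableAt ℝ χ.1 x := fun χ =>
        (χ.2.1.contDiffAt ((isOpen_config L).mem_nhds hx)).differentiableAt (by simp)
      simp [Set.indicator_of_mem hx, fderiv_add (hd ψ) (hd φ)]
    · simp [Set.indicator_of_notMem hx]
  map_smul' c ψ := by
    ext1
    funext x
    by_cases hx : x ∈ config L
    · have hd : DifferentiableAt ℝ ψ.1 x :=
        (ψ.2.1.contDiffAt ((isOpen_config L).mem_nhds hx)).differentiableAt (by simp)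
      simp [Set.indicator_of_mem hx, fderiv_const_smul hd c]
    · simp [Set.indicator_of_notMem hx]

/-- Multiplication of wave functions by `1 / (x_j - x_k)`; it is used for `j ≠ k` only. -/
def invDiffOp (m n L : ℕ) (j k : Fin L) : Module.End ℂ (Wave m n L) where
  toFun ψ := ⟨fun x => (1 / (x j - x k)) • ψ.1 x, by
    refine ⟨?_, fun x hx => by simp [ψ.2.2 x hx]⟩
    by_cases hjk : j = k
    · subst hjk
      simpa using contDiffOn_const
    · refine ContDiffOn.smul (ContDiffOn.div contDiffOn_const ?_ ?_) ψ.2.1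
      · exact ((contDiff_apply ℝ ℝ j).sub (contDiff_apply ℝ ℝ k)).contDiffOn
      · exact fun x hx => sub_ne_zero.2 (hx j k hjk)⟩
  map_add' ψ φ := by
    ext1
    funext x
    exact smul_add _ _ _
  map_smul' c ψ := by
    ext1
    funext x
    exact smul_comm (1 / (x j - x k)) c (ψ.1 x)

/-- `J_0^{ab} = ∑_j σ_j^{ab}`. -/
def J0 (m n L : ℕ) (a b : Fin (m + n)) : Module.End ℂ (Wave m n L) :=
  ∑ j, spinOp m n L (sigma m n L j a b)

/-- `J_1^{ab} = ∑_j σ_j^{ab} ∂/∂x_j - λ ∑_{j ≠ k} (σ_j σ_k)^{ab} / (x_j - x_k)`. -/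
def J1 (m n L : ℕ) (lam : ℂ) (a b : Fin (m + n)) : Module.End ℂ (Wave m n L) :=
  (∑ j, spinOp m n L (sigma m n L j a b) * partialOp m n L j) -
    lam • ∑ j, ∑ k ∈ Finset.univ.filter (· ≠ j),
      spinOp m n L (sigmaSigma m n L j k a b) * invDiffOp m n L j k

/-- The graded commutator `[A, B] = A B - (-1)^{p q} B A` of homogeneous operators `A` of parity
`p` and `B` of parity `q`. -/
def gradedComm {R : Type*} [Ring R] [Algebra ℂ R] (p q : ℕ) (A B : R) : R :=
  A * B - (-1 : ℂ) ^ (p * q) • (B * A)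

/-- The parity `[a] + [b]` of `e^{ab}`, `σ^{ab}`, `J_0^{ab}` and `J_1^{ab}`. -/
def par (m n : ℕ) (a b : Fin (m + n)) : ℕ := grade m n a + grade m n b

end

end OspCalogero

/-! The relations hold because `J1` comes from a trivial realization by commuting with a spin
Calogero Hamiltonian. Put `s_j = σ_j^{ab}`. Since the coordinates commute with each other and with
the spins, `∑ s_j` and `∑ x_j s_j` realize the degree 0 and 1 part of the polynomial current algebra
of `osp(m|n)`; for them all three relations follow from the one-site brackets and the graded Jacobi
identity (`gradedComm_moment_serre`).

Let `H = ∑ ∂_i² + ∑_{j,k} V_{jk} / (x_j - x_k)²` with `V_{jk} = λ Ω_{jk} - λ²`, where `Ω` is the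
split Casimir operator. Then `ad H` kills `∑ s_j` by invariance of `Ω`, and sends `∑ x_j s_j` to `2
J1` (`lie_hamiltonian_moment`, `gen_comm_casimir`, `current_eq`). It kills `J1` exactly because of
the choice of `λ` (`lie_hamiltonian_current`): three-body terms cancel by the infinitesimal braid
relations of `Ω`, and two-body terms reduce to `2[V, s_j] + 2(s_j - s_k)V + [V, [V, s_j]] = 0`. With
`Ω = P - Q`, a graded permutation minus a contraction satisfying Brauer algebra relations, this
identity amounts to `λ(m - n - 4) = 2` (`perm_contr_double_comm`).

As `ad H` is a derivation, applying it once to the bracket of `∑ s_j` with `∑ x_j s_j` gives the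
second relation for every `λ`. Applying it twice to the cubic relation gives the third: a bracket of
two elements that are killed by `(ad H)²` becomes twice the bracket of their images. -/

namespace OspCalogero

/-! ### Signs and conjugation of indices -/

theorem grade_eq (m n : ℕ) (a : Fin (m + n)) : grade m n a = 0 ∨ grade m n a = 1 := by
  unfold grade; split_ifs <;> simp

theorem bar_val (m n : ℕ) (a : Fin (m + n)) :
    (bar m n a : ℕ) = if (a : ℕ) < m then m - 1 - a else 2 * m + n - 1 - a := by
  unfold bar; split_ifs <;> rfl

theorem bar_bar (m n : ℕ) (a : Fin (m + n)) : bar m n (bar m n a) = a := by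
  ext
  rw [bar_val, bar_val]
  have := a.2
  split_ifs <;> omega

theorem bar_inj (m n : ℕ) {a b : Fin (m + n)} : bar m n a = bar m n b ↔ a = b :=
  (Function.LeftInverse.injective (bar_bar m n)).eq_iff

theorem grade_bar (m n : ℕ) (a : Fin (m + n)) : grade m n (bar m n a) = grade m n a := by
  unfold grade
  rw [bar_val]
  have := a.2
  split_ifs <;> omega

theorem xi_mul_self (m n : ℕ) (a : Fin (m + n)) : xi m n a * xi m n a = 1 := by
  unfold xi; split_ifs <;> simp

/-- Conjugation preserves the even block, where `ξ = 1`; for even `n` it exchanges the two halves of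
the odd block, on which `ξ` has opposite signs. -/
theorem xi_bar (m n : ℕ) (hn : Even n) (a : Fin (m + n)) :
    xi m n (bar m n a) = (-1) ^ grade m n a * xi m n a := by
  obtain ⟨k, rfl⟩ := hn
  unfold xi bar grade
  have := a.2
  split_ifs with h1 h2 h2 <;> simp at * <;> omega

/-- Conjugation of indices as a permutation. -/
def barEquiv (m n : ℕ) : Equiv.Perm (Fin (m + n)) :=
  (Function.Involutive.toPerm (bar m n) (bar_bar m n))

theorem sum_bar {M : Type*} [AddCommMonoid M] (m n : ℕ) (F : Fin (m + n) → M) :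
    ∑ a, F (bar m n a) = ∑ a, F a :=
  Equiv.sum_comp (barEquiv m n) F

theorem sum_grade_sign (m n : ℕ) :
    ∑ a : Fin (m + n), (-1 : ℂ) ^ grade m n a = (m : ℂ) - n := by
  rw [Fin.sum_univ_add]
  simp [grade, sub_eq_add_neg]

/-! ### Matrix units of the graded tensor product -/

/-- Matrix units of a graded tensor product of copies of `gl(m|n)`, in an associative algebra. -/
structure IsGradedUnits {R ι : Type*} [Ring R] [Algebra ℂ R] (m n : ℕ)
    (e : ι → Fin (m + n) → Fin (m + n) → R) : Prop where
  mul_same : ∀ j a b c d, e j a b * e j c d = if b = c then e j a d else 0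
  mul_ne : ∀ j k, j ≠ k → ∀ a b c d,
    e j a b * e k c d = (-1 : ℂ) ^ (par m n a b * par m n c d) • (e k c d * e j a b)
  sum_one : ∀ j, ∑ a, e j a a = 1

theorem IsGradedUnits.map {R S ι : Type*} [Ring R] [Algebra ℂ R] [Ring S] [Algebra ℂ S] {m n : ℕ}
    {e : ι → Fin (m + n) → Fin (m + n) → R} (h : IsGradedUnits m n e) (φ : R →ₐ[ℂ] S) :
    IsGradedUnits m n fun j a b => φ (e j a b) where
  mul_same j a b c d := by
    rw [← map_mul, h.mul_same]; split_ifs <;> simp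
  mul_ne j k hjk a b c d := by
    rw [← map_mul, h.mul_ne j k hjk, map_smul, map_mul]
  sum_one j := by rw [← map_sum, h.sum_one, map_one]

theorem siteE_apply (m n L : ℕ) (j : Fin L) (a b : Fin (m + n)) (ψ : Spin m n L)
    (q : Fin L → Fin (m + n)) :
    siteE m n L j a b ψ q = if q j = a then
      (-1 : ℂ) ^ ((grade m n a + grade m n b) * ∑ i ∈ Finset.univ.filter (· < j), grade m n (q i))
        * ψ (Function.update q j b)
    else 0 := rfl

theorem sum_grade_update_of_le (m n L : ℕ) {j k : Fin L} (h : j ≤ k) (q : Fin L → Fin (m + n))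
    (a : Fin (m + n)) :
    ∑ i ∈ Finset.univ.filter (· < j), grade m n (Function.update q k a i) =
      ∑ i ∈ Finset.univ.filter (· < j), grade m n (q i) := by
  refine Finset.sum_congr rfl fun i hi => ?_
  rw [Function.update_of_ne (ne_of_lt (lt_of_lt_of_le (Finset.mem_filter.1 hi).2 h))]

/-- Stated additively, since a difference of grades would be truncated in `ℕ`. -/
theorem sum_grade_update_of_lt (m n L : ℕ) {j k : Fin L} (h : k < j) (q : Fin L → Fin (m + n))
    (a : Fin (m + n)) :
    ∑ i ∈ Finset.univ.filter (· < j), grade m n (Function.update q k a i) + grade m n (q k) =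
      ∑ i ∈ Finset.univ.filter (· < j), grade m n (q i) + grade m n a := by
  have hk : k ∈ Finset.univ.filter (· < j) := by simp [h]
  rw [← Finset.add_sum_erase _ _ hk, ← Finset.add_sum_erase _ (fun i => grade m n (q i)) hk]
  have : ∑ i ∈ (Finset.univ.filter (· < j)).erase k, grade m n (Function.update q k a i) =
      ∑ i ∈ (Finset.univ.filter (· < j)).erase k, grade m n (q i) := by
    refine Finset.sum_congr rfl fun i hi => ?_
    rw [Function.update_of_ne (Finset.ne_of_mem_erase hi)]
  rw [this]
  simp
  ring

theorem siteE_mul_same (m n L : ℕ) (j : Fin L) (a b c d : Fin (m + n)) :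
    siteE m n L j a b * siteE m n L j c d = if b = c then siteE m n L j a d else 0 := by
  refine LinearMap.ext fun ψ => funext fun q => ?_
  rw [Module.End.mul_apply, siteE_apply]
  by_cases hbc : b = c
  · subst hbc
    by_cases hq : q j = a
    · rw [if_pos hq, siteE_apply, if_pos (by simp), if_pos rfl, siteE_apply, if_pos hq,
        sum_grade_update_of_le m n L le_rfl, Function.update_idem, ← mul_assoc, ← pow_add]
      congr 1
      generalize (∑ i ∈ Finset.univ.filter (· < j), grade m n (q i)) = S
      rw [show (grade m n a + grade m n b) * S + (grade m n b + grade m n d) * S =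
        (grade m n a + grade m n d) * S + 2 * (grade m n b * S) by ring, pow_add, pow_mul (-1 : ℂ) 2]
      simp
    · rw [if_neg hq, if_pos rfl, siteE_apply, if_neg hq]
  · simp [hbc, siteE_apply]

/-- The operator at `k` counts the grades to its left, and the operator at `j < k` changes that
count by `[a] + [b]` modulo 2. The operator at `j` does not see site `k`. This difference is the
graded sign. -/
theorem siteE_mul_lt (m n L : ℕ) {j k : Fin L} (hjk : j < k) (a b c d : Fin (m + n)) :
    siteE m n L j a b * siteE m n L k c d =
      (-1 : ℂ) ^ (par m n a b * par m n c d) • (siteE m n L k c d * siteE m n L j a b) := by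
  refine LinearMap.ext fun ψ => funext fun q => ?_
  rw [LinearMap.smul_apply, Pi.smul_apply, Module.End.mul_apply, Module.End.mul_apply]
  simp only [siteE_apply, Function.update_of_ne hjk.ne, Function.update_of_ne hjk.ne', smul_eq_mul]
  by_cases h1 : q j = a
  · by_cases h2 : q k = c
    · simp only [h1, h2, if_true]
      rw [sum_grade_update_of_le m n L hjk.le, Function.update_comm hjk.ne]
      have hs := sum_grade_update_of_lt m n L hjk q b
      rw [h1] at hs
      rw [par, par]
      generalize (∑ i ∈ Finset.univ.filter (· < k), grade m n (Function.update q j b i)) = S at *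
      generalize (∑ i ∈ Finset.univ.filter (· < k), grade m n (q i)) = T at *
      generalize (∑ i ∈ Finset.univ.filter (· < j), grade m n (q i)) = U at *
      rw [mul_left_comm, ← mul_assoc, ← mul_assoc, ← mul_assoc, ← pow_add, ← pow_add, ← pow_add]
      congr 1
      have hS : (-1 : ℂ) ^ ((grade m n c + grade m n d) * S) =
          (-1 : ℂ) ^ ((grade m n c + grade m n d) * (T + grade m n a + grade m n b)) := by
        rw [show T + grade m n a + grade m n b = S + 2 * grade m n a by omega, mul_add, pow_add,
          mul_left_comm, pow_mul (-1 : ℂ) 2]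
        simp
      rw [pow_add, hS, ← pow_add]
      congr 1
      ring
    · simp [h2]
  · by_cases h2 : q k = c <;> simp [h1]

theorem siteE_isGradedUnits (m n L : ℕ) : IsGradedUnits m n (siteE m n L) where
  mul_same := siteE_mul_same m n L
  mul_ne j k hjk a b c d := by
    rcases lt_or_gt_of_ne hjk with h | h
    · exact siteE_mul_lt m n L h a b c d
    · rw [siteE_mul_lt m n L h c d a b, smul_smul, ← pow_add, mul_comm (par m n c d), ← two_mul,
        pow_mul]
      simp
  sum_one j := by
    refine LinearMap.ext fun ψ => funext fun q => ?_
    rw [LinearMap.sum_apply, Finset.sum_apply, Finset.sum_eq_single (q j)]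
    · rw [siteE_apply, if_pos rfl, Function.update_eq_self, ← two_mul, mul_assoc, pow_mul]
      simp
    · intro a _ ha
      rw [siteE_apply, if_neg (Ne.symm ha)]
    · simp

/-! ### Graded permutation `P` and contraction `Q`: Brauer algebra relations -/

section SpinAlgebra

variable {R ι : Type*} [Ring R] [Algebra ℂ R] {m n : ℕ}

/-- The matrix unit `e^{ab}` with its first index lowered. -/
def lowered (e : ι → Fin (m + n) → Fin (m + n) → R) (j : ι) (a b : Fin (m + n)) : R :=
  xi m n a • e j (bar m n a) b

/-- The generator `σ_j^{ab}` built from matrix units. -/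
def ospGen (e : ι → Fin (m + n) → Fin (m + n) → R) (j : ι) (a b : Fin (m + n)) : R :=
  lowered e j a b - (-1 : ℂ) ^ (grade m n a * grade m n b) • lowered e j b a

/-- `(σ_j σ_k)^{ab}`. -/
def ospGenMul (e : ι → Fin (m + n) → Fin (m + n) → R) (j k : ι) (a b : Fin (m + n)) : R :=
  ∑ c, xi m n c • (ospGen e j a c * ospGen e k (bar m n c) b)

/-- The graded permutation of the factors `j` and `k`. -/
def permOp (e : ι → Fin (m + n) → Fin (m + n) → R) (j k : ι) : R :=
  ∑ a, ∑ b, (-1 : ℂ) ^ grade m n b • (e j a b * e k b a)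

/-- The contraction of the factors `j` and `k` with the metric. -/
def contrOp (e : ι → Fin (m + n) → Fin (m + n) → R) (j k : ι) : R :=
  ∑ a, ∑ b, (xi m n a * xi m n b * (-1 : ℂ) ^ (grade m n a * grade m n b)) •
    (e j b a * e k (bar m n b) (bar m n a))

/-- The split Casimir operator of the factors `j` and `k`. -/
def casimirOp (e : ι → Fin (m + n) → Fin (m + n) → R) (j k : ι) : R :=
  ∑ a, ∑ b, (xi m n a * xi m n b) • (ospGen e j a b * lowered e k (bar m n b) (bar m n a))

variable {e : ι → Fin (m + n) → Fin (m + n) → R}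

theorem neg_one_pow_mul_self (k : ℕ) : (-1 : ℂ) ^ k * (-1) ^ k = 1 := by
  rw [← pow_add, ← two_mul, pow_mul]; simp

theorem xi_mul_xi_bar (hn : Even n) (a : Fin (m + n)) :
    xi m n a * xi m n (bar m n a) = (-1) ^ grade m n a := by
  rw [xi_bar m n hn, mul_left_comm, xi_mul_self, mul_one]

/-- This and `mul_perm_right` expand the two sides of `perm_mul` in the same products `e_j^{ad}
e_k^{ca}`, so that only signs remain to be compared. -/
theorem IsGradedUnits.perm_mul_left (h : IsGradedUnits m n e) {j k : ι} (hjk : j ≠ k)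
    (c d : Fin (m + n)) :
    permOp e j k * e j c d = ∑ a, (-1 : ℂ) ^ (grade m n c + (grade m n a + grade m n c) *
      (grade m n c + grade m n d)) • (e j a d * e k c a) := by
  have key : ∀ a b, (e j a b * e k b a) * e j c d = if b = c then
      (-1 : ℂ) ^ ((grade m n a + grade m n b) * (grade m n c + grade m n d)) •
        (e j a d * e k b a) else 0 := by
    intro a b
    rw [mul_assoc, h.mul_ne k j hjk.symm, mul_smul_comm, ← mul_assoc, h.mul_same]
    split_ifs
    · rw [par, par, add_comm (grade m n b)]
    · simp
  simp only [permOp, Finset.sum_mul, smul_mul_assoc, key, smul_ite, smul_zero,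
    Finset.sum_ite_eq', Finset.mem_univ, if_true, smul_smul, ← pow_add]

theorem IsGradedUnits.mul_perm_right (h : IsGradedUnits m n e) {j k : ι} (hjk : j ≠ k)
    (c d : Fin (m + n)) :
    e k c d * permOp e j k = ∑ a, (-1 : ℂ) ^ (grade m n c + (grade m n a + grade m n c) *
      (grade m n c + grade m n d)) • (e j a d * e k c a) := by
  have key : ∀ a b, e k c d * (e j a b * e k b a) = if d = b then
      (-1 : ℂ) ^ ((grade m n a + grade m n b) * (grade m n c + grade m n d)) •
        (e j a d * e k c a) else 0 := by
    intro a b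
    rw [← mul_assoc, h.mul_ne k j hjk.symm, smul_mul_assoc, mul_assoc, h.mul_same]
    split_ifs with hd
    · rw [par, par, mul_comm, hd]
    · simp
  simp only [permOp, Finset.mul_sum, mul_smul_comm, key, smul_ite, smul_zero,
    Finset.sum_ite_eq, Finset.mem_univ, if_true, smul_smul, ← pow_add]
  refine Finset.sum_congr rfl fun a _ => ?_
  congr 1
  rcases grade_eq m n a with ha | ha <;> rcases grade_eq m n c with hc | hc <;>
    rcases grade_eq m n d with hd | hd <;> simp [ha, hc, hd, pow_succ]

theorem IsGradedUnits.perm_mul (h : IsGradedUnits m n e) {j k : ι} (hjk : j ≠ k)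
    (c d : Fin (m + n)) : permOp e j k * e j c d = e k c d * permOp e j k := by
  rw [h.perm_mul_left hjk, h.mul_perm_right hjk]

theorem IsGradedUnits.perm_symm (h : IsGradedUnits m n e) {j k : ι} (hjk : j ≠ k) :
    permOp e k j = permOp e j k := by
  rw [permOp, permOp, Finset.sum_comm]
  refine Finset.sum_congr rfl fun a _ => Finset.sum_congr rfl fun b _ => ?_
  rw [h.mul_ne k j hjk.symm, smul_smul]
  congr 1
  simp only [par]
  rcases grade_eq m n a with ha | ha <;> rcases grade_eq m n b with hb | hb <;>
    simp [ha, hb, pow_succ]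

/-- Multiplication by `P` turns the summands of `P` into `e_j^{dd} e_k^{cc}`, which sum to the
identity. -/
theorem IsGradedUnits.perm_sq (h : IsGradedUnits m n e) {j k : ι} (hjk : j ≠ k) :
    permOp e j k * permOp e j k = 1 := by
  have key : ∀ c d, permOp e j k * ((-1 : ℂ) ^ grade m n d • (e j c d * e k d c)) =
      e j d d * e k c c := by
    intro c d
    rw [mul_smul_comm, ← mul_assoc, h.perm_mul_left hjk]
    simp only [Finset.sum_mul, smul_mul_assoc, mul_assoc, h.mul_same, mul_ite, mul_zero, smul_ite,
      smul_zero, Finset.sum_ite_eq', Finset.mem_univ, if_true, smul_smul]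
    rw [← pow_add]
    convert one_smul ℂ _
    rcases grade_eq m n d with ha | ha <;> rcases grade_eq m n c with hb | hb <;>
      simp [ha, hb, pow_succ]
  rw [show permOp e j k * permOp e j k = ∑ c, ∑ d, permOp e j k *
    ((-1 : ℂ) ^ grade m n d • (e j c d * e k d c)) by
      simp only [← Finset.mul_sum]; rfl]
  simp only [key]
  rw [Finset.sum_comm]
  simp only [← Finset.mul_sum, h.sum_one, mul_one]

theorem IsGradedUnits.contr_mul_left (h : IsGradedUnits m n e) {j k : ι} (hjk : j ≠ k)
    (c d : Fin (m + n)) :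
    contrOp e j k * e j c d = ∑ b, (xi m n c * xi m n b * (-1 : ℂ) ^ (grade m n c * grade m n b +
      (grade m n b + grade m n c) * (grade m n c + grade m n d))) •
        (e j b d * e k (bar m n b) (bar m n c)) := by
  have key : ∀ a b, (e j b a * e k (bar m n b) (bar m n a)) * e j c d = if a = c then
      (-1 : ℂ) ^ ((grade m n b + grade m n c) * (grade m n c + grade m n d)) •
        (e j b d * e k (bar m n b) (bar m n a)) else 0 := by
    intro a b
    rw [mul_assoc, h.mul_ne k j hjk.symm, mul_smul_comm, ← mul_assoc, h.mul_same]
    split_ifs with hac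
    · rw [par, par, grade_bar, grade_bar, hac]
    · simp
  rw [contrOp, Finset.sum_comm]
  simp only [Finset.sum_mul, smul_mul_assoc, key, smul_ite, smul_zero,
    Finset.sum_ite_eq', Finset.mem_univ, if_true, smul_smul, mul_assoc, ← pow_add]

theorem IsGradedUnits.contr_mul_right (h : IsGradedUnits m n e) {j k : ι}
    (c d : Fin (m + n)) :
    contrOp e j k * e k c d = ∑ b, (xi m n (bar m n c) * xi m n b *
      (-1 : ℂ) ^ (grade m n c * grade m n b)) • (e j b (bar m n c) * e k (bar m n b) d) := by
  have key : ∀ a b, (e j b a * e k (bar m n b) (bar m n a)) * e k c d = if a = bar m n c then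
        (e j b a * e k (bar m n b) d) else 0 := by
    intro a b
    have : bar m n a = c ↔ a = bar m n c := by rw [← bar_inj m n, bar_bar]
    rw [mul_assoc, h.mul_same, if_congr this rfl rfl]
    simp
  rw [contrOp, Finset.sum_comm]
  simp only [Finset.sum_mul, smul_mul_assoc, key, smul_ite, smul_zero,
    Finset.sum_ite_eq', Finset.mem_univ, if_true, grade_bar]

/-- Invariance of the metric: next to `Q`, a matrix unit on factor `j` may be replaced by its graded
transpose on factor `k`. -/
theorem IsGradedUnits.contr_mul (h : IsGradedUnits m n e) {j k : ι} (hjk : j ≠ k)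
    (c d : Fin (m + n)) :
    contrOp e j k * e j c d = (xi m n c * xi m n d * (-1 : ℂ) ^ (grade m n c +
      grade m n c * grade m n d)) • (contrOp e j k * e k (bar m n d) (bar m n c)) := by
  rw [h.contr_mul_left hjk, h.contr_mul_right, bar_bar, Finset.smul_sum]
  refine Finset.sum_congr rfl fun b _ => ?_
  rw [smul_smul, grade_bar]
  congr 1
  have hs : (-1 : ℂ) ^ (grade m n c * grade m n b +
      (grade m n b + grade m n c) * (grade m n c + grade m n d)) = (-1 : ℂ) ^ (grade m n c +
      grade m n c * grade m n d) * (-1 : ℂ) ^ (grade m n d * grade m n b) := by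
    rcases grade_eq m n b with ha | ha <;> rcases grade_eq m n c with hc | hc <;>
      rcases grade_eq m n d with hd | hd <;> simp [ha, hc, hd, pow_succ]
  rw [hs]
  linear_combination (-(xi m n c * xi m n b * ((-1 : ℂ) ^ (grade m n c +
      grade m n c * grade m n d) * (-1 : ℂ) ^ (grade m n d * grade m n b)))) * xi_mul_self m n d

theorem IsGradedUnits.mul_contr_left (h : IsGradedUnits m n e) {j k : ι}
    (c d : Fin (m + n)) :
    e j c d * contrOp e j k = ∑ a, (xi m n a * xi m n d * (-1 : ℂ) ^ (grade m n a * grade m n d)) •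
        (e j c a * e k (bar m n d) (bar m n a)) := by
  have key : ∀ a b, e j c d * (e j b a * e k (bar m n b) (bar m n a)) = if d = b then
        (e j c a * e k (bar m n d) (bar m n a)) else 0 := by
    intro a b
    rw [← mul_assoc, h.mul_same]
    split_ifs with hd
    · rw [hd]
    · simp
  simp only [contrOp, Finset.mul_sum, mul_smul_comm, key, smul_ite, smul_zero,
    Finset.sum_ite_eq, Finset.mem_univ, if_true]

theorem IsGradedUnits.mul_contr_right (h : IsGradedUnits m n e) {j k : ι} (hjk : j ≠ k)
    (c d : Fin (m + n)) :
    e k c d * contrOp e j k = ∑ a, (xi m n a * xi m n (bar m n d) *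
      (-1 : ℂ) ^ (grade m n a * grade m n d + (grade m n c + grade m n d) *
        (grade m n a + grade m n d))) • (e j (bar m n d) a * e k c (bar m n a)) := by
  have key : ∀ a b, e k c d * (e j b a * e k (bar m n b) (bar m n a)) = if bar m n d = b then
      (-1 : ℂ) ^ ((grade m n c + grade m n d) * (grade m n a + grade m n d)) •
        (e j (bar m n d) a * e k c (bar m n a)) else 0 := by
    intro a b
    have : d = bar m n b ↔ bar m n d = b := by rw [← bar_inj m n, bar_bar]
    rw [← mul_assoc, h.mul_ne k j hjk.symm, smul_mul_assoc, mul_assoc, h.mul_same, if_congr this rfl rfl]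
    split_ifs with hd
    · rw [par, par, ← hd, grade_bar, add_comm (grade m n d) (grade m n a)]
    · simp
  simp only [contrOp, Finset.mul_sum, mul_smul_comm, key, smul_ite, smul_zero,
    Finset.sum_ite_eq, Finset.mem_univ, if_true, smul_smul, mul_assoc, ← pow_add, grade_bar]

theorem IsGradedUnits.mul_contr (h : IsGradedUnits m n e) {j k : ι} (hjk : j ≠ k)
    (c d : Fin (m + n)) :
    e j c d * contrOp e j k = (xi m n c * xi m n d * (-1 : ℂ) ^ (grade m n c +
      grade m n c * grade m n d)) • (e k (bar m n d) (bar m n c) * contrOp e j k) := by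
  rw [h.mul_contr_left, h.mul_contr_right hjk, bar_bar, Finset.smul_sum]
  refine Finset.sum_congr rfl fun b _ => ?_
  rw [smul_smul, grade_bar, grade_bar]
  congr 1
  have hs : (-1 : ℂ) ^ (grade m n b * grade m n d) = (-1 : ℂ) ^ (grade m n c +
      grade m n c * grade m n d) * (-1 : ℂ) ^ (grade m n b * grade m n c +
        (grade m n d + grade m n c) * (grade m n b + grade m n c)) := by
    rcases grade_eq m n b with ha | ha <;> rcases grade_eq m n c with hc | hc <;>
      rcases grade_eq m n d with hd | hd <;> simp [ha, hc, hd, pow_succ]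
  rw [hs]
  linear_combination (-(xi m n d * xi m n b * ((-1 : ℂ) ^ (grade m n c +
      grade m n c * grade m n d) * (-1 : ℂ) ^ (grade m n b * grade m n c +
        (grade m n d + grade m n c) * (grade m n b + grade m n c))))) * xi_mul_self m n c

/-- Conjugating both summation indices matches the two sums; the signs of `xi_bar` make up for
reordering the factors. -/
theorem IsGradedUnits.contr_symm (h : IsGradedUnits m n e) (hn : Even n) {j k : ι} (hjk : j ≠ k) :
    contrOp e k j = contrOp e j k := by
  have key : ∀ a b, (xi m n a * xi m n b * (-1 : ℂ) ^ (grade m n a * grade m n b)) •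
      (e k b a * e j (bar m n b) (bar m n a)) =
      (fun a b => (xi m n a * xi m n b * (-1 : ℂ) ^ (grade m n a * grade m n b)) •
        (e j b a * e k (bar m n b) (bar m n a))) (bar m n a) (bar m n b) := by
    intro a b
    simp only [bar_bar, grade_bar]
    rw [h.mul_ne k j hjk.symm, smul_smul, xi_bar m n hn, xi_bar m n hn]
    congr 1
    simp only [par, grade_bar]
    rcases grade_eq m n a with ha | ha <;> rcases grade_eq m n b with hb | hb <;>
      simp [ha, hb, pow_succ]
  rw [contrOp, contrOp]
  simp only [key]
  rw [← sum_bar m n]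
  refine Finset.sum_congr rfl fun a _ => ?_
  simp only [bar_bar]
  rw [← sum_bar m n]
  simp only [bar_bar]

/-- Each `e_j` in `P` is moved through `Q` onto factor `k`, where it multiplies the other matrix
unit. What survives is `Q` times a resolution of the identity. -/
theorem IsGradedUnits.contr_mul_perm (h : IsGradedUnits m n e) (hn : Even n) {j k : ι}
    (hjk : j ≠ k) : contrOp e j k * permOp e j k = contrOp e j k := by
  have key : ∀ c d, contrOp e j k * ((-1 : ℂ) ^ grade m n d • (e j c d * e k d c)) =
      if d = bar m n c then contrOp e j k * e k c c else 0 := by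
    intro c d
    have : bar m n c = d ↔ d = bar m n c := eq_comm
    rw [mul_smul_comm, ← mul_assoc, h.contr_mul hjk, smul_mul_assoc, mul_assoc (contrOp e j k),
      h.mul_same, if_congr this rfl rfl]
    split_ifs with hd
    · subst hd
      rw [bar_bar, smul_smul, xi_mul_xi_bar hn, grade_bar]
      convert one_smul ℂ _
      rcases grade_eq m n c with hc | hc <;> simp [hc]
    · simp
  rw [show contrOp e j k * permOp e j k = ∑ c, ∑ d, contrOp e j k *
    ((-1 : ℂ) ^ grade m n d • (e j c d * e k d c)) by
      simp only [← Finset.mul_sum]; rfl]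
  simp only [key, Finset.sum_ite_eq', Finset.mem_univ, if_true, ← Finset.mul_sum, h.sum_one,
    mul_one]

/-- The same transposition leaves a resolution of the identity on factor `k` and a free sum of
`(-1)^{[d]}`, the superdimension `m - n`. -/
theorem IsGradedUnits.contr_sq (h : IsGradedUnits m n e) {j k : ι} (hjk : j ≠ k) :
    contrOp e j k * contrOp e j k = ((m : ℂ) - n) • contrOp e j k := by
  have key : ∀ c d, contrOp e j k * ((xi m n c * xi m n d * (-1 : ℂ) ^ (grade m n c * grade m n d)) •
      (e j d c * e k (bar m n d) (bar m n c))) = (-1 : ℂ) ^ grade m n d •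
        (contrOp e j k * e k (bar m n c) (bar m n c)) := by
    intro c d
    rw [mul_smul_comm, ← mul_assoc, h.contr_mul hjk, smul_mul_assoc, mul_assoc (contrOp e j k),
      h.mul_same, if_pos rfl, smul_smul]
    congr 1
    have h1 := xi_mul_self m n c
    have h2 := xi_mul_self m n d
    rw [show xi m n c * xi m n d * (-1 : ℂ) ^ (grade m n c * grade m n d) * (xi m n d * xi m n c *
      (-1 : ℂ) ^ (grade m n d + grade m n d * grade m n c)) = (xi m n c * xi m n c) *
      (xi m n d * xi m n d) * ((-1 : ℂ) ^ (grade m n c * grade m n d) *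
      (-1 : ℂ) ^ (grade m n d + grade m n d * grade m n c)) by ring, h1, h2]
    rcases grade_eq m n c with hc | hc <;> rcases grade_eq m n d with hd | hd <;> simp [hc, hd]
  rw [show contrOp e j k * contrOp e j k = ∑ c, ∑ d, contrOp e j k *
    ((xi m n c * xi m n d * (-1 : ℂ) ^ (grade m n c * grade m n d)) •
      (e j d c * e k (bar m n d) (bar m n c))) by
      simp only [← Finset.mul_sum]; rfl]
  simp only [key, ← Finset.sum_smul, sum_grade_sign, ← Finset.smul_sum, ← Finset.mul_sum]
  rw [sum_bar m n fun c => e k c c, h.sum_one, mul_one]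

end SpinAlgebra

/-! ### Supersymmetry of the metric and sums against it -/

theorem metric_comm (m n : ℕ) (hn : Even n) (a b : Fin (m + n)) :
    metric m n a b = (-1) ^ (grade m n a * grade m n b) * metric m n b a := by
  by_cases h : a = bar m n b
  · subst h
    rw [metric, metric, if_pos rfl, if_pos (bar_bar m n b).symm, xi_bar m n hn, grade_bar]
    rcases grade_eq m n b with hb | hb <;> simp [hb]
  · have h' : ¬ b = bar m n a := fun hb => h (by rw [hb, bar_bar])
    simp [metric, h, h']

theorem metric_of_grade_ne (m n : ℕ) {a b : Fin (m + n)} (h : grade m n a ≠ grade m n b) :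
    metric m n a b = 0 := by
  rw [metric, if_neg]
  rintro rfl
  exact h (grade_bar m n b)

theorem sum_metric_left {M : Type*} [AddCommGroup M] [Module ℂ M] {m n : ℕ} (b : Fin (m + n))
    (F : Fin (m + n) → M) : ∑ c, metric m n c b • F c = xi m n (bar m n b) • F (bar m n b) := by
  simp [metric]

theorem sum_metric_right {M : Type*} [AddCommGroup M] [Module ℂ M] {m n : ℕ} (a : Fin (m + n))
    (F : Fin (m + n) → M) : ∑ d, metric m n a d • F d = xi m n a • F (bar m n a) := by
  have : ∀ d, a = bar m n d ↔ d = bar m n a := fun d => by rw [← bar_inj m n, bar_bar, eq_comm]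
  simp [metric, this]

/-! ### Split Casimir operator, braid relations and the two-body identity -/

section SpinAlgebra

variable {R ι : Type*} [Ring R] [Algebra ℂ R] {m n : ℕ}
  {e : ι → Fin (m + n) → Fin (m + n) → R}

theorem IsGradedUnits.perm_mul_gen (h : IsGradedUnits m n e) {j k : ι} (hjk : j ≠ k)
    (a b : Fin (m + n)) : permOp e j k * ospGen e j a b = ospGen e k a b * permOp e j k := by
  simp only [ospGen, lowered, mul_sub, sub_mul, mul_smul_comm, smul_mul_assoc, h.perm_mul hjk]

theorem IsGradedUnits.contr_mul_lowered (h : IsGradedUnits m n e) (hn : Even n) {j k : ι}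
    (hjk : j ≠ k) (a b : Fin (m + n)) : contrOp e j k * lowered e j a b =
      (-1 : ℂ) ^ (grade m n a * grade m n b) • (contrOp e j k * lowered e k b a) := by
  rw [lowered, lowered, mul_smul_comm, h.contr_mul hjk, mul_smul_comm, smul_smul, smul_smul,
    bar_bar, ← mul_assoc, ← mul_assoc, xi_mul_xi_bar hn, grade_bar]
  congr 1
  rcases grade_eq m n a with ha | ha <;> rcases grade_eq m n b with hb | hb <;> simp [ha, hb]

theorem IsGradedUnits.lowered_mul_contr (h : IsGradedUnits m n e) (hn : Even n) {j k : ι}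
    (hjk : j ≠ k) (a b : Fin (m + n)) : lowered e j a b * contrOp e j k =
      (-1 : ℂ) ^ (grade m n a * grade m n b) • (lowered e k b a * contrOp e j k) := by
  rw [lowered, lowered, smul_mul_assoc, h.mul_contr hjk, smul_mul_assoc, smul_smul, smul_smul,
    bar_bar, ← mul_assoc, ← mul_assoc, xi_mul_xi_bar hn, grade_bar]
  congr 1
  rcases grade_eq m n a with ha | ha <;> rcases grade_eq m n b with hb | hb <;> simp [ha, hb]

/-- The generators are antisymmetric under graded transposition, so moving one across `Q` changes
its sign. -/
theorem IsGradedUnits.contr_mul_gen (h : IsGradedUnits m n e) (hn : Even n) {j k : ι}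
    (hjk : j ≠ k) (a b : Fin (m + n)) :
    contrOp e j k * ospGen e k a b = -(contrOp e j k * ospGen e j a b) := by
  rw [ospGen, ospGen, mul_sub, mul_sub, mul_smul_comm, mul_smul_comm, h.contr_mul_lowered hn hjk,
    h.contr_mul_lowered hn hjk, smul_smul, mul_comm (grade m n b), neg_one_pow_mul_self, one_smul]
  abel

theorem IsGradedUnits.gen_mul_contr (h : IsGradedUnits m n e) (hn : Even n) {j k : ι}
    (hjk : j ≠ k) (a b : Fin (m + n)) :
    ospGen e k a b * contrOp e j k = -(ospGen e j a b * contrOp e j k) := by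
  rw [ospGen, ospGen, sub_mul, sub_mul, smul_mul_assoc, smul_mul_assoc, h.lowered_mul_contr hn hjk,
    h.lowered_mul_contr hn hjk, smul_smul, mul_comm (grade m n b), neg_one_pow_mul_self, one_smul]
  abel

theorem casimirOp_eq (hn : Even n) (j k : ι) :
    casimirOp e j k = permOp e j k - contrOp e j k := by
  have h1 : permOp e j k = ∑ a, ∑ b, (xi m n a * xi m n b) •
      (lowered e j a b * lowered e k (bar m n b) (bar m n a)) := by
    rw [permOp, ← sum_bar m n]
    refine Finset.sum_congr rfl fun a _ => Finset.sum_congr rfl fun b _ => ?_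
    rw [lowered, lowered, smul_mul_smul_comm, smul_smul, bar_bar]
    congr 1
    rw [mul_mul_mul_comm, xi_mul_self, one_mul, xi_mul_xi_bar hn]
  have h2 : contrOp e j k = ∑ a, ∑ b, (xi m n a * xi m n b *
      (-1 : ℂ) ^ (grade m n a * grade m n b)) •
      (lowered e j b a * lowered e k (bar m n b) (bar m n a)) := by
    rw [contrOp]
    refine Finset.sum_congr rfl fun a _ => ?_
    rw [← sum_bar m n]
    refine Finset.sum_congr rfl fun b _ => ?_
    rw [lowered, lowered, smul_mul_smul_comm, smul_smul, bar_bar, grade_bar, xi_mul_xi_bar hn,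
      xi_bar m n hn]
    congr 1
    ring
  rw [h1, h2, casimirOp, ← Finset.sum_sub_distrib]
  refine Finset.sum_congr rfl fun a _ => ?_
  rw [← Finset.sum_sub_distrib]
  refine Finset.sum_congr rfl fun b _ => ?_
  rw [ospGen, sub_mul, smul_sub, smul_mul_assoc, smul_smul]

theorem IsGradedUnits.casimir_symm (h : IsGradedUnits m n e) (hn : Even n) {j k : ι}
    (hjk : j ≠ k) : casimirOp e k j = casimirOp e j k := by
  rw [casimirOp_eq hn, casimirOp_eq hn, h.perm_symm hjk, h.contr_symm hn hjk]

/-- `P` exchanges the two summands, and `Q` annihilates their sum from either side. -/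
theorem IsGradedUnits.casimir_comm_gen_add (h : IsGradedUnits m n e) (hn : Even n) {j k : ι}
    (hjk : j ≠ k) (a b : Fin (m + n)) :
    Commute (casimirOp e j k) (ospGen e j a b + ospGen e k a b) := by
  have hp := h.perm_mul_gen hjk.symm a b
  rw [h.perm_symm hjk] at hp
  rw [Commute, SemiconjBy, casimirOp_eq hn, sub_mul, mul_sub, mul_add, mul_add, add_mul, add_mul,
    h.perm_mul_gen hjk, hp, h.contr_mul_gen hn hjk, h.gen_mul_contr hn hjk]
  abel

theorem IsGradedUnits.commute_mul (h : IsGradedUnits m n e) {j k l : ι} (hjl : j ≠ l) (hkl : k ≠ l)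
    (a b c d a' b' : Fin (m + n)) (hp : Even (par m n a b + par m n a' b')) :
    Commute (e j a b * e k a' b') (e l c d) := by
  rw [Commute, SemiconjBy, mul_assoc, h.mul_ne k l hkl, mul_smul_comm, ← mul_assoc,
    h.mul_ne j l hjl, smul_mul_assoc, smul_smul, ← pow_add, mul_assoc, ← add_mul,
    add_comm (par m n a' b'), pow_mul, hp.neg_one_pow, one_pow, one_smul]

theorem IsGradedUnits.casimir_comm (h : IsGradedUnits m n e) (hn : Even n) {j k l : ι}
    (hjl : j ≠ l) (hkl : k ≠ l) (c d : Fin (m + n)) : Commute (casimirOp e j k) (e l c d) := by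
  rw [casimirOp_eq hn]
  refine Commute.sub_left ?_ ?_
  · refine Commute.sum_left _ _ _ fun a _ => Commute.sum_left _ _ _ fun b _ =>
      (h.commute_mul hjl hkl _ _ _ _ _ _ ?_).smul_left _
    rw [par, par, add_comm (grade m n b)]
    exact ⟨_, rfl⟩
  · refine Commute.sum_left _ _ _ fun a _ => Commute.sum_left _ _ _ fun b _ =>
      (h.commute_mul hjl hkl _ _ _ _ _ _ ?_).smul_left _
    rw [par, par, grade_bar, grade_bar]
    exact ⟨_, rfl⟩

theorem commute_lowered {x : R} {l : ι} (hx : ∀ c d, Commute x (e l c d)) (a b : Fin (m + n)) :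
    Commute x (lowered e l a b) := (hx _ _).smul_right _

theorem commute_ospGen {x : R} {l : ι} (hx : ∀ c d, Commute x (e l c d)) (a b : Fin (m + n)) :
    Commute x (ospGen e l a b) :=
  (commute_lowered hx a b).sub_right ((commute_lowered hx b a).smul_right _)

theorem IsGradedUnits.casimir_comm_casimir (h : IsGradedUnits m n e) (hn : Even n)
    {j k l i : ι} (hjl : j ≠ l) (hkl : k ≠ l) (hji : j ≠ i) (hki : k ≠ i) :
    Commute (casimirOp e j k) (casimirOp e l i) :=
  Commute.sum_right _ _ _ fun _ _ => Commute.sum_right _ _ _ fun _ _ =>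
    ((commute_ospGen (h.casimir_comm hn hjl hkl) _ _).mul_right
      (commute_lowered (h.casimir_comm hn hji hki) _ _)).smul_right _

/-- `Ω_{jl} + Ω_{kl}` is linear in the generators `σ_j + σ_k`, which commute with `Ω_{jk}`; the
remaining factor lives on site `l`. -/
theorem IsGradedUnits.casimir_braid (h : IsGradedUnits m n e) (hn : Even n) {j k l : ι}
    (hjk : j ≠ k) (hjl : j ≠ l) (hkl : k ≠ l) :
    Commute (casimirOp e j k) (casimirOp e j l + casimirOp e k l) := by
  have : casimirOp e j l + casimirOp e k l = ∑ a, ∑ b, (xi m n a * xi m n b) •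
      ((ospGen e j a b + ospGen e k a b) * lowered e l (bar m n b) (bar m n a)) := by
    simp only [casimirOp, ← Finset.sum_add_distrib, add_mul, smul_add]
  rw [this]
  exact Commute.sum_right _ _ _ fun a _ => Commute.sum_right _ _ _ fun b _ =>
    ((h.casimir_comm_gen_add hn hjk a b).mul_right
      (commute_lowered (h.casimir_comm hn hjl hkl) _ _)).smul_right _

/-- Here `s` and `t` stand for `σ_j` and `σ_k`. In the sum the terms in `P` cancel, and the shift
`-λ²` in `V` cancels the `s - t` produced by `P² = 1`. There remains `λ(λ(N - 4) - 2)(Qs + sQ)`,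
which fixes `λ`. -/
theorem perm_contr_double_comm {P Q s t : R} {N lam : ℂ} (hlam : lam * (N - 4) = 2)
    (hPP : P * P = 1) (hPQ : P * Q = Q) (hQP : Q * P = Q) (hQQ : Q * Q = N • Q)
    (hPs : P * s = t * P) (hPt : P * t = s * P) (hQt : Q * t = -(Q * s)) (htQ : t * Q = -(s * Q))
    {V : R} (hV : V = lam • (P - Q) - (lam * lam) • (1 : R)) :
    (2 : ℂ) • (V * s - s * V) + (2 : ℂ) • ((s - t) * V) +
      (V * (V * s - s * V) - (V * s - s * V) * V) = 0 := by
  have hQsQ : Q * (s * Q) = 0 := by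
    -- Writing the first `Q` as `QP` and moving `P` to the right replaces `s` by `t`, which changes
    -- the sign next to `Q`.
    have h1 : Q * (s * Q) = -(Q * (s * Q)) :=
      calc Q * (s * Q) = (Q * P) * (s * Q) := by rw [hQP]
        _ = Q * (P * s) * Q := by noncomm_ring
        _ = Q * t * (P * Q) := by rw [hPs]; noncomm_ring
        _ = -(Q * (s * Q)) := by rw [hPQ, hQt]; noncomm_ring
    have h2 : (2 : ℂ) • (Q * (s * Q)) = 0 := by rw [two_smul]; nth_rw 1 [h1]; simp
    simpa using h2
  have hQsP : Q * (s * P) = -(Q * s) := by rw [← hPt, ← mul_assoc, hQP, hQt]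
  have ePQ : ∀ x, P * (Q * x) = Q * x := fun x => by rw [← mul_assoc, hPQ]
  have eQQ : ∀ x, Q * (Q * x) = N • (Q * x) := fun x => by rw [← mul_assoc, hQQ, smul_mul_assoc]
  have ePs : ∀ x, P * (s * x) = t * (P * x) := fun x => by rw [← mul_assoc, hPs, mul_assoc]
  have ePt : ∀ x, P * (t * x) = s * (P * x) := fun x => by rw [← mul_assoc, hPt, mul_assoc]
  have eQt : ∀ x, Q * (t * x) = -(Q * (s * x)) := fun x => by
    rw [← mul_assoc, hQt, neg_mul, mul_assoc]
  have hW : V * s - s * V = lam • (t * P - s * P - Q * s + s * Q) := by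
    rw [hV]
    simp only [sub_mul, mul_sub, smul_mul_assoc, mul_smul_comm, mul_one, one_mul, hPs]
    module
  rw [hW, hV]
  simp only [sub_mul, mul_sub, add_mul, mul_add, smul_mul_assoc, mul_smul_comm, mul_one, one_mul,
    mul_assoc, hPP, hPQ, hQP, hQQ, htQ, ePQ, eQQ, ePs, ePt, eQt, hQsP, hQsQ]
  match_scalars <;> first | ring1 | linear_combination lam * hlam

theorem IsGradedUnits.two_body (h : IsGradedUnits m n e) (hn : Even n) {lam : ℂ}
    (hlam : lam * ((m : ℂ) - n - 4) = 2) {j k : ι} (hjk : j ≠ k) (a b : Fin (m + n)) {V : R}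
    (hV : V = lam • casimirOp e j k - (lam * lam) • (1 : R)) :
    (2 : ℂ) • (V * ospGen e j a b - ospGen e j a b * V) +
      (2 : ℂ) • ((ospGen e j a b - ospGen e k a b) * V) +
      (V * (V * ospGen e j a b - ospGen e j a b * V) -
        (V * ospGen e j a b - ospGen e j a b * V) * V) = 0 := by
  have hp := h.perm_mul_gen hjk.symm a b
  rw [h.perm_symm hjk] at hp
  have hPQ : permOp e j k * contrOp e j k = contrOp e j k := by
    have h1 : permOp e j k * contrOp e j k = contrOp e k j * permOp e j k := by
      simp only [contrOp, Finset.mul_sum, Finset.sum_mul, mul_smul_comm, smul_mul_assoc]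
      refine Finset.sum_congr rfl fun a _ => Finset.sum_congr rfl fun b _ => ?_
      have h2 := h.perm_mul hjk.symm (bar m n b) (bar m n a)
      rw [h.perm_symm hjk] at h2
      rw [← mul_assoc, h.perm_mul hjk, mul_assoc (e k b a), h2, ← mul_assoc]
    rw [h1, h.contr_symm hn hjk, h.contr_mul_perm hn hjk]
  rw [casimirOp_eq hn] at hV
  exact perm_contr_double_comm hlam (h.perm_sq hjk) hPQ (h.contr_mul_perm hn hjk) (h.contr_sq hjk)
    (h.perm_mul_gen hjk a b) hp (h.contr_mul_gen hn hjk a b) (h.gen_mul_contr hn hjk a b) hV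

end SpinAlgebra

/-! ### Formal properties of the graded commutator -/

section GradedComm

variable {R : Type*} [Ring R] [Algebra ℂ R]

theorem gradedComm_smul_left (p q : ℕ) (c : ℂ) (A B : R) :
    gradedComm p q (c • A) B = c • gradedComm p q A B := by
  simp only [gradedComm, smul_mul_assoc, mul_smul_comm, smul_sub, smul_comm c]

theorem gradedComm_smul_right (p q : ℕ) (c : ℂ) (A B : R) :
    gradedComm p q A (c • B) = c • gradedComm p q A B := by
  simp only [gradedComm, smul_mul_assoc, mul_smul_comm, smul_sub, smul_comm c]

theorem gradedComm_zero_right (p q : ℕ) (A : R) : gradedComm p q A 0 = 0 := by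
  simp [gradedComm]

theorem gradedComm_zero_left (p q : ℕ) (A : R) : gradedComm p q 0 A = 0 := by
  simp [gradedComm]

theorem gradedComm_sum_left {ι : Type*} (s : Finset ι) (p q : ℕ) (A : ι → R) (B : R) :
    gradedComm p q (∑ i ∈ s, A i) B = ∑ i ∈ s, gradedComm p q (A i) B := by
  simp only [gradedComm, Finset.sum_mul, Finset.mul_sum, Finset.smul_sum, Finset.sum_sub_distrib]

theorem gradedComm_sum_right {ι : Type*} (s : Finset ι) (p q : ℕ) (A : R) (B : ι → R) :
    gradedComm p q A (∑ i ∈ s, B i) = ∑ i ∈ s, gradedComm p q A (B i) := by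
  simp only [gradedComm, Finset.sum_mul, Finset.mul_sum, Finset.smul_sum, Finset.sum_sub_distrib]

/-- The graded commutator is bilinear over elements that commute with its arguments. -/
theorem gradedComm_mul_mul (p q : ℕ) {x y A B : R} (hxB : Commute x B) (hyA : Commute y A)
    (hxy : Commute x y) : gradedComm p q (x * A) (y * B) = x * y * gradedComm p q A B := by
  rw [gradedComm, gradedComm, mul_sub, mul_smul_comm]
  congr 1
  · rw [mul_assoc, ← mul_assoc A, ← hyA.eq, mul_assoc, mul_assoc]
  · rw [mul_assoc y, ← mul_assoc B, ← hxB.eq, mul_assoc x, ← mul_assoc, hxy.eq]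

/-- The parities are mere labels: the identity only uses that signs square to 1, so no grading of
`R` is needed. -/
theorem gradedComm_jacobi (p q r : ℕ) (A B C : R) :
    gradedComm p (q + r) A (gradedComm q r B C) =
      (-1 : ℂ) ^ (p * q) • gradedComm q (p + r) B (gradedComm p r A C) +
        gradedComm (p + q) r (gradedComm p q A B) C := by
  simp only [gradedComm, mul_sub, sub_mul, mul_smul_comm, smul_mul_assoc, smul_sub, smul_smul,
    mul_add, add_mul, pow_add, mul_assoc, mul_comm q p]
  have h := neg_one_pow_mul_self (p * q)
  generalize (-1 : ℂ) ^ (p * q) = u at *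
  generalize (-1 : ℂ) ^ (p * r) = v at *
  generalize (-1 : ℂ) ^ (q * r) = w at *
  match_scalars <;> first | ring1 | linear_combination w * h | linear_combination -(w * v) * h

end GradedComm

/-! ### Brackets of the `osp(m|n)` generators with each other and with the Casimir operator -/

section SpinAlgebra

variable {R ι : Type*} [Ring R] [Algebra ℂ R] {m n : ℕ}
  {e : ι → Fin (m + n) → Fin (m + n) → R}

theorem IsGradedUnits.lowered_mul_ne (h : IsGradedUnits m n e) {j k : ι} (hjk : j ≠ k)
    (a b c d : Fin (m + n)) : lowered e j a b * lowered e k c d =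
      (-1 : ℂ) ^ (par m n a b * par m n c d) • (lowered e k c d * lowered e j a b) := by
  simp only [lowered, smul_mul_smul_comm]
  rw [h.mul_ne j k hjk, smul_comm, mul_comm (xi m n a)]
  simp only [par, grade_bar]

theorem IsGradedUnits.gen_mul_lowered_ne (h : IsGradedUnits m n e) {j k : ι} (hjk : j ≠ k)
    (a b c d : Fin (m + n)) : ospGen e j a b * lowered e k c d =
      (-1 : ℂ) ^ (par m n a b * par m n c d) • (lowered e k c d * ospGen e j a b) := by
  have hp : par m n b a = par m n a b := add_comm _ _
  rw [ospGen, sub_mul, mul_sub, smul_mul_assoc, mul_smul_comm, h.lowered_mul_ne hjk,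
    h.lowered_mul_ne hjk, smul_sub, hp, smul_comm]

theorem IsGradedUnits.gen_mul_ne (h : IsGradedUnits m n e) {j k : ι} (hjk : j ≠ k)
    (a b c d : Fin (m + n)) : ospGen e j a b * ospGen e k c d =
      (-1 : ℂ) ^ (par m n a b * par m n c d) • (ospGen e k c d * ospGen e j a b) := by
  have hp : par m n d c = par m n c d := add_comm _ _
  rw [ospGen.eq_def e k c d, sub_mul, mul_sub, smul_mul_assoc, mul_smul_comm,
    h.gen_mul_lowered_ne hjk, h.gen_mul_lowered_ne hjk, smul_sub, hp, smul_comm]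

theorem IsGradedUnits.gradedComm_gen_ne (h : IsGradedUnits m n e) {j k : ι} (hjk : j ≠ k)
    (a b c d : Fin (m + n)) :
    gradedComm (par m n a b) (par m n c d) (ospGen e j a b) (ospGen e k c d) = 0 := by
  rw [gradedComm, h.gen_mul_ne hjk, sub_self]

theorem IsGradedUnits.lowered_mul_same (h : IsGradedUnits m n e) (j : ι) (a b c d : Fin (m + n)) :
    lowered e j a b * lowered e j c d = metric m n c b • lowered e j a d := by
  have hb : b = bar m n c ↔ c = bar m n b := by rw [← bar_inj m n, bar_bar, eq_comm]
  rw [lowered, lowered, lowered, smul_mul_smul_comm, h.mul_same, metric, if_congr hb rfl rfl]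
  split_ifs
  · rw [smul_smul, mul_comm]
  · simp

theorem IsGradedUnits.gradedComm_gen_same (h : IsGradedUnits m n e) (hn : Even n) (j : ι)
    (a b c d : Fin (m + n)) :
    gradedComm (par m n a b) (par m n c d) (ospGen e j a b) (ospGen e j c d) =
        metric m n c b • ospGen e j a d
          - (-1 : ℂ) ^ (par m n a b * par m n c d) • metric m n a d • ospGen e j c b
          - (-1 : ℂ) ^ (grade m n c * grade m n d) •
            (metric m n d b • ospGen e j a c
              - (-1 : ℂ) ^ (par m n a b * par m n c d) • metric m n a c • ospGen e j d b) := by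
  simp only [gradedComm, ospGen, mul_sub, sub_mul, smul_mul_assoc, mul_smul_comm,
    h.lowered_mul_same]
  rw [metric_comm m n hn b c, metric_comm m n hn b d, metric_comm m n hn c a,
    metric_comm m n hn d a]
  have h1 := @metric_of_grade_ne m n c b
  have h2 := @metric_of_grade_ne m n d b
  have h3 := @metric_of_grade_ne m n a c
  have h4 := @metric_of_grade_ne m n a d
  simp only [par]
  -- For fixed grades, metric entries between different blocks vanish and all signs become explicit.
  rcases grade_eq m n a with ha | ha <;> rcases grade_eq m n b with hb | hb <;>
    rcases grade_eq m n c with hc | hc <;> rcases grade_eq m n d with hd | hd <;>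
    simp only [ha, hb, hc, hd] at h1 h2 h3 h4 ⊢ <;> norm_num at h1 h2 h3 h4 <;>
    (try simp only [*]) <;> norm_num <;> module

/-- This is where `(σ_j σ_k)^{ab}` in `J1` comes from. The bracket of generators has four terms,
each with a metric that collapses one sum: the two terms whose metric carries `b` give `(σ_j
σ_k)^{ab}`, the two carrying `a` give `-(σ_k σ_j)^{ab}`. -/
theorem IsGradedUnits.gen_comm_casimir (h : IsGradedUnits m n e) (hn : Even n) {j k : ι}
    (hjk : j ≠ k) (a b : Fin (m + n)) :
    ospGen e j a b * casimirOp e j k - casimirOp e j k * ospGen e j a b =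
      ospGenMul e j k a b - ospGenMul e k j a b := by
  have key : ∀ c d, ospGen e j a b * (ospGen e j c d * lowered e k (bar m n d) (bar m n c)) -
      (ospGen e j c d * lowered e k (bar m n d) (bar m n c)) * ospGen e j a b =
      gradedComm (par m n a b) (par m n c d) (ospGen e j a b) (ospGen e j c d) *
        lowered e k (bar m n d) (bar m n c) := by
    intro c d
    have hp : par m n (bar m n d) (bar m n c) = par m n c d := by
      rw [par, par, grade_bar, grade_bar, add_comm]
    have h1 := h.gen_mul_lowered_ne hjk a b (bar m n d) (bar m n c)
    rw [hp] at h1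
    have h2 : lowered e k (bar m n d) (bar m n c) * ospGen e j a b =
        (-1 : ℂ) ^ (par m n a b * par m n c d) •
          (ospGen e j a b * lowered e k (bar m n d) (bar m n c)) := by
      rw [h1, smul_smul, neg_one_pow_mul_self, one_smul]
    rw [gradedComm, sub_mul, smul_mul_assoc, mul_assoc (ospGen e j c d), h2, mul_smul_comm,
      mul_assoc, mul_assoc]
  have hsum : ospGen e j a b * casimirOp e j k - casimirOp e j k * ospGen e j a b =
      ∑ c, ∑ d, (xi m n c * xi m n d) •
        (gradedComm (par m n a b) (par m n c d) (ospGen e j a b) (ospGen e j c d) *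
        lowered e k (bar m n d) (bar m n c)) := by
    simp only [← key, casimirOp, Finset.mul_sum, Finset.sum_mul, ← Finset.sum_sub_distrib,
      mul_smul_comm, smul_mul_assoc, smul_sub]
  have t1 : ∑ c, ∑ d, metric m n c b • (xi m n c * xi m n d) •
      (ospGen e j a d * lowered e k (bar m n d) (bar m n c)) =
      ∑ c, xi m n c • (ospGen e j a c * lowered e k (bar m n c) b) := by
    rw [Finset.sum_comm]
    refine Finset.sum_congr rfl fun d _ => ?_
    rw [sum_metric_left b fun c => (xi m n c * xi m n d) •
      (ospGen e j a d * lowered e k (bar m n d) (bar m n c)), bar_bar, smul_smul, ← mul_assoc,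
      xi_mul_self, one_mul]
  have t3 : ∑ c, ∑ d, metric m n d b • (-1 : ℂ) ^ (grade m n c * grade m n d) •
      (xi m n c * xi m n d) • (ospGen e j a c * lowered e k (bar m n d) (bar m n c)) =
      ∑ c, xi m n c • (ospGen e j a c * (-1 : ℂ) ^ (grade m n (bar m n c) * grade m n b) •
        lowered e k b (bar m n c)) := by
    refine Finset.sum_congr rfl fun c _ => ?_
    rw [sum_metric_left b fun d => (-1 : ℂ) ^ (grade m n c * grade m n d) •
      (xi m n c * xi m n d) • (ospGen e j a c * lowered e k (bar m n d) (bar m n c)), bar_bar,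
      mul_smul_comm, smul_smul, smul_smul, smul_smul, grade_bar, grade_bar]
    congr 1
    linear_combination (-1 : ℂ) ^ (grade m n c * grade m n b) * xi m n c *
      xi_mul_self m n (bar m n b)
  -- The summation index is conjugated and factor `j` moved to the left, to match the order of
  -- factors in the Casimir operator.
  have hswap : ospGenMul e k j a b = ∑ c, (-1 : ℂ) ^ (grade m n c + (grade m n a + grade m n c) *
      (grade m n c + grade m n b)) • xi m n c • (ospGen e j c b *
        (lowered e k a (bar m n c) - (-1 : ℂ) ^ (grade m n a * grade m n c) •
          lowered e k (bar m n c) a)) := by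
    rw [ospGenMul, ← sum_bar m n]
    refine Finset.sum_congr rfl fun c _ => ?_
    rw [h.gen_mul_ne hjk.symm, bar_bar, xi_bar m n hn, par, par, grade_bar,
      ospGen.eq_def e k a, grade_bar, smul_smul, smul_smul]
    congr 1
    rw [pow_add]
    ring
  have t2 : ∑ c, ∑ d, metric m n a d • (-1 : ℂ) ^ (par m n a b * par m n c d) •
      (xi m n c * xi m n d) • (ospGen e j c b * lowered e k (bar m n d) (bar m n c)) =
      ∑ c, (-1 : ℂ) ^ (grade m n c + (grade m n a + grade m n c) *
      (grade m n c + grade m n b)) • xi m n c • (ospGen e j c b * lowered e k a (bar m n c)) := by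
    refine Finset.sum_congr rfl fun c _ => ?_
    rw [sum_metric_right a fun d => (-1 : ℂ) ^ (par m n a b * par m n c d) •
      (xi m n c * xi m n d) • (ospGen e j c b * lowered e k (bar m n d) (bar m n c)), bar_bar,
      smul_smul, smul_smul, smul_smul, xi_bar m n hn, par, par, grade_bar]
    congr 1
    rw [show ∀ x y z w : ℂ, x * y * (z * (w * x)) = x * x * (w * y * z) from
      fun x y z w => by ring, xi_mul_self, one_mul]
    congr 1
    rcases grade_eq m n a with ha | ha <;> rcases grade_eq m n b with hb | hb <;>
      rcases grade_eq m n c with hc | hc <;> simp [ha, hb, hc, pow_succ]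
  have t4 : ∑ c, ∑ d, metric m n a c • (-1 : ℂ) ^ (grade m n c * grade m n d) •
      (-1 : ℂ) ^ (par m n a b * par m n c d) •
      (xi m n c * xi m n d) • (ospGen e j d b * lowered e k (bar m n d) (bar m n c)) =
      ∑ c, (-1 : ℂ) ^ (grade m n c + (grade m n a + grade m n c) *
      (grade m n c + grade m n b)) • xi m n c • (ospGen e j c b *
        (-1 : ℂ) ^ (grade m n a * grade m n c) • lowered e k (bar m n c) a) := by
    rw [Finset.sum_comm]
    refine Finset.sum_congr rfl fun d _ => ?_
    rw [sum_metric_right a fun c => (-1 : ℂ) ^ (grade m n c * grade m n d) •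
      (-1 : ℂ) ^ (par m n a b * par m n c d) •
      (xi m n c * xi m n d) • (ospGen e j d b * lowered e k (bar m n d) (bar m n c)), bar_bar,
      mul_smul_comm, smul_smul, smul_smul, smul_smul, smul_smul, smul_smul, xi_bar m n hn, par, par,
      grade_bar]
    congr 1
    rw [show ∀ x y z w v : ℂ, x * y * z * (w * x * v) = x * x * (w * y * z * v) from
      fun x y z w v => by ring, xi_mul_self, one_mul, mul_right_comm _ (xi m n d)]
    congr 1
    rcases grade_eq m n a with ha | ha <;> rcases grade_eq m n b with hb | hb <;>
      rcases grade_eq m n d with hc | hc <;> simp [ha, hb, hc, pow_succ]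
  have hjk' : ospGenMul e j k a b = ∑ c, xi m n c • (ospGen e j a c * lowered e k (bar m n c) b) -
      ∑ c, xi m n c • (ospGen e j a c * (-1 : ℂ) ^ (grade m n (bar m n c) * grade m n b) •
        lowered e k b (bar m n c)) := by
    rw [ospGenMul, ← Finset.sum_sub_distrib]
    refine Finset.sum_congr rfl fun c _ => ?_
    rw [ospGen.eq_def e k, mul_sub, smul_sub]
  simp only [mul_sub, smul_sub, Finset.sum_sub_distrib] at hswap
  rw [hsum, hjk', hswap, ← t1, ← t2, ← t3, ← t4]
  simp only [h.gradedComm_gen_same hn, sub_mul, smul_sub, Finset.sum_sub_distrib, smul_mul_assoc]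
  simp only [smul_comm (xi m n _ * xi m n _), smul_comm ((-1 : ℂ) ^ _) (metric m n _ _)]
  abel

end SpinAlgebra

/-! ### Calogero Hamiltonian with an abstract invariant pair interaction -/

section Calogero

attribute [local instance] LieRing.ofAssociativeRing LieAlgebra.ofAssociativeAlgebra

variable {A ι : Type*} [Ring A] [Algebra ℂ A] [Fintype ι] [DecidableEq ι]

/-- Coordinates `x_i`, derivatives `d_i` and inverse differences `u_{jk} = 1 / (x_j - x_k)`, with
the convention `u_{jj} = 0`. -/
structure IsConfigOps (x d : ι → A) (u : ι → ι → A) : Prop where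
  d_d : ∀ i j, Commute (d i) (d j)
  x_u : ∀ i j k, Commute (x i) (u j k)
  x_x : ∀ i j, Commute (x i) (x j)
  u_u : ∀ j k l i, Commute (u j k) (u l i)
  lie_d_x : ∀ i j, ⁅d i, x j⁆ = if i = j then 1 else 0
  lie_d_u : ∀ i j k, ⁅d i, u j k⁆ =
    ((if i = k then (1 : ℂ) else 0) - (if i = j then (1 : ℂ) else 0)) • (u j k * u j k)
  u_self : ∀ j, u j j = 0
  u_swap : ∀ j k, u k j = -u j k
  sub_mul_u : ∀ j k, j ≠ k → (x j - x k) * u j k = 1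

/-- Operators on an internal space: a pair interaction `V_{jk}` that is invariant and satisfies the
infinitesimal braid relations, and a family `s_j` on which it acts. -/
structure IsPairInteraction (x d : ι → A) (u V : ι → ι → A) (s : ι → A) : Prop where
  x_V : ∀ i j k, Commute (x i) (V j k)
  d_V : ∀ i j k, Commute (d i) (V j k)
  u_V : ∀ j k l i, Commute (u j k) (V l i)
  x_s : ∀ i j, Commute (x i) (s j)
  d_s : ∀ i j, Commute (d i) (s j)
  u_s : ∀ j k l, Commute (u j k) (s l)
  V_symm : ∀ j k, j ≠ k → V k j = V j k
  V_s_ne : ∀ j k l, j ≠ l → k ≠ l → Commute (V j k) (s l)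
  V_s_add : ∀ j k, j ≠ k → Commute (V j k) (s j + s k)
  V_V_ne : ∀ j k l i, j ≠ l → k ≠ l → j ≠ i → k ≠ i → Commute (V j k) (V l i)
  V_V_add : ∀ j k l, j ≠ k → j ≠ l → k ≠ l → Commute (V j k) (V j l + V k l)

/-- `∑ ∂_i² + ∑ V_{jk} / (x_j - x_k)²`. -/
def hamiltonian (d : ι → A) (u V : ι → ι → A) : A :=
  ∑ i, d i * d i + ∑ j, ∑ k, V j k * (u j k * u j k)

/-- `2 ∑ s_i ∂_i + ∑ [V_{jk}, s_j] / (x_j - x_k)`. -/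
def current (d : ι → A) (u V : ι → ι → A) (s : ι → A) : A :=
  (2 : ℂ) • ∑ i, s i * d i + ∑ j, ∑ k, u j k * ⁅V j k, s j⁆

theorem lie_mul_right (a b c : A) : ⁅a, b * c⁆ = ⁅a, b⁆ * c + b * ⁅a, c⁆ := by
  simp only [Ring.lie_def]; noncomm_ring

theorem lie_mul_left (a b c : A) : ⁅a * b, c⁆ = a * ⁅b, c⁆ + ⁅a, c⁆ * b := by
  simp only [Ring.lie_def]; noncomm_ring

theorem lie_eq_zero_of_commute {a b : A} (h : Commute a b) : ⁅a, b⁆ = 0 := by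
  rw [Ring.lie_def, h.eq, sub_self]

theorem _root_.Commute.lie_right_of_ring {a b c : A} (hb : Commute a b) (hc : Commute a c) :
    Commute a ⁅b, c⁆ := by
  rw [Ring.lie_def]; exact (hb.mul_right hc).sub_right (hc.mul_right hb)

theorem lie_mul_mul {v a b w : A} (hav : Commute a v) (haw : Commute a w) (hbv : Commute b v)
    (hab : Commute a b) : ⁅v * a, b * w⁆ = a * b * ⁅v, w⁆ := by
  rw [lie_mul_right, lie_mul_left, lie_eq_zero_of_commute hab, lie_eq_zero_of_commute hbv.symm,
    lie_mul_left, lie_eq_zero_of_commute haw, ← (hav.lie_right_of_ring haw).eq]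
  simp only [mul_zero, zero_mul, zero_add, ← mul_assoc, hab.eq]

variable {x d : ι → A} {u V : ι → ι → A} {s : ι → A}

theorem IsPairInteraction.lie_swap (hV : IsPairInteraction x d u V s) {j k : ι} (hjk : j ≠ k) :
    ⁅V j k, s k⁆ = -⁅V j k, s j⁆ := by
  have h := lie_eq_zero_of_commute (hV.V_s_add j k hjk)
  rw [lie_add] at h
  exact eq_neg_of_add_eq_zero_right h

theorem IsPairInteraction.sum_lie (hV : IsPairInteraction x d u V s) {j k : ι} (hjk : j ≠ k)
    (F : ι → A → A) (hF : ∀ l, F l 0 = 0) :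
    ∑ l, F l ⁅V j k, s l⁆ = F j ⁅V j k, s j⁆ + F k (-⁅V j k, s j⁆) := by
  rw [Fintype.sum_eq_add j k hjk, hV.lie_swap hjk]
  rintro l ⟨h1, h2⟩
  rw [lie_eq_zero_of_commute (hV.V_s_ne j k l h1.symm h2.symm), hF]

theorem IsPairInteraction.u_lie (hV : IsPairInteraction x d u V s) (i l j k p : ι) :
    Commute (u i l) ⁅V j k, s p⁆ := (hV.u_V i l j k).lie_right_of_ring (hV.u_s i l p)

theorem lie_hamiltonian_sum (hu : IsConfigOps x d u) (hV : IsPairInteraction x d u V s) :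
    ⁅hamiltonian d u V, ∑ i, s i⁆ = 0 := by
  rw [hamiltonian, add_lie, sum_lie]
  simp only [sum_lie]
  have h1 : ∀ i, ⁅d i * d i, ∑ l, s l⁆ = 0 := fun i => lie_eq_zero_of_commute
    (Commute.sum_right _ _ _ fun l _ => (hV.d_s i l).mul_left (hV.d_s i l))
  have h2 : ∀ j k, ⁅V j k * (u j k * u j k), ∑ l, s l⁆ = 0 := by
    intro j k
    by_cases hjk : j = k
    · subst hjk; simp [hu.u_self]
    · rw [lie_mul_left, lie_eq_zero_of_commute (Commute.sum_right _ _ _ fun l _ =>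
        (hV.u_s j k l).mul_left (hV.u_s j k l)), lie_sum, hV.sum_lie hjk (fun _ a => a) (by simp)]
      simp only [add_neg_cancel, zero_mul, mul_zero, add_zero]
  simp [h1, h2]

/-- The kinetic term differentiates `x_i`. In the potential term `[V_{jk}, s_k] = -[V_{jk}, s_j]`,
so a factor `x_j - x_k` appears and lowers `u_{jk}²` to `u_{jk}`. -/
theorem lie_hamiltonian_moment (hu : IsConfigOps x d u) (hV : IsPairInteraction x d u V s) :
    ⁅hamiltonian d u V, ∑ i, x i * s i⁆ = current d u V s := by
  rw [hamiltonian, current, add_lie, sum_lie]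
  simp only [sum_lie]
  congr 1
  · rw [Finset.smul_sum]
    refine Finset.sum_congr rfl fun i _ => ?_
    rw [lie_sum, Finset.sum_eq_single i]
    · rw [lie_mul_right, lie_mul_left, hu.lie_d_x, if_pos rfl, lie_eq_zero_of_commute
        ((hV.d_s i i).mul_left (hV.d_s i i)), mul_one, one_mul, mul_zero, add_zero, ← two_smul ℂ,
        smul_mul_assoc, (hV.d_s i i).eq]
    · intro j _ hj
      rw [lie_mul_right, lie_mul_left, hu.lie_d_x, if_neg hj.symm, lie_eq_zero_of_commute
        ((hV.d_s i j).mul_left (hV.d_s i j))]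
      simp
    · simp
  · refine Finset.sum_congr rfl fun j _ => Finset.sum_congr rfl fun k _ => ?_
    by_cases hjk : j = k
    · subst hjk; simp [hu.u_self]
    · have h : ∀ l, ⁅V j k * (u j k * u j k), x l * s l⁆ =
          u j k * u j k * x l * ⁅V j k, s l⁆ := fun l =>
        lie_mul_mul ((hV.u_V j k j k).mul_left (hV.u_V j k j k))
          ((hV.u_s j k l).mul_left (hV.u_s j k l)) (hV.x_V l j k)
          ((hu.x_u l j k).symm.mul_left (hu.x_u l j k).symm)
      rw [lie_sum]
      simp only [h]
      rw [hV.sum_lie hjk (fun l a => u j k * u j k * x l * a) (by simp), mul_neg, ← sub_eq_add_neg,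
        ← sub_mul, ← mul_sub, mul_assoc (u j k),
        ← ((hu.x_u j j k).sub_left (hu.x_u k j k)).eq, hu.sub_mul_u j k hjk, mul_one]

theorem IsConfigOps.lie_d_sq_u (hu : IsConfigOps x d u) {j k : ι} (hjk : j ≠ k) :
    ∑ i, ⁅d i * d i, u j k⁆ = (2 : ℂ) • (u j k * u j k * (d k - d j)) +
      (4 : ℂ) • (u j k * u j k * u j k) := by
  have h : ∀ i, ⁅d i * d i, u j k⁆ =
      (2 * ((if i = k then (1 : ℂ) else 0) - (if i = j then (1 : ℂ) else 0))) •
        (u j k * u j k * d i) +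
      (2 * (((if i = k then (1 : ℂ) else 0) - (if i = j then (1 : ℂ) else 0)) *
        ((if i = k then (1 : ℂ) else 0) - (if i = j then (1 : ℂ) else 0)))) •
        (u j k * u j k * u j k) := by
    intro i
    have h1 : d i * (u j k * u j k) = u j k * u j k * d i + ⁅d i, u j k * u j k⁆ := by
      rw [Ring.lie_def]; abel
    rw [lie_mul_left, hu.lie_d_u, mul_smul_comm, h1, lie_mul_right, hu.lie_d_u, smul_mul_assoc,
      smul_mul_assoc, mul_smul_comm, ← mul_assoc]
    module
  simp only [h, Finset.sum_add_distrib, ← Finset.sum_smul, ← Finset.mul_sum]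
  congr 1
  · simp only [mul_sub, sub_smul, Finset.sum_sub_distrib, mul_ite, mul_one, mul_zero, ite_smul,
      zero_smul, Finset.sum_ite_eq', Finset.mem_univ, if_true, smul_sub]
  · congr 1
    rw [Fintype.sum_eq_add j k hjk]
    · simp [hjk, hjk.symm]; norm_num
    · rintro l ⟨h1, h2⟩
      simp [h1, h2]

theorem lie_pair_kinetic (hu : IsConfigOps x d u) (hV : IsPairInteraction x d u V s) {j k : ι}
    (hjk : j ≠ k) :
    ⁅V j k * (u j k * u j k), ∑ i, s i * d i⁆ =
      u j k * u j k * ⁅V j k, s j⁆ * (d j - d k) +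
        (2 : ℂ) • (u j k * u j k * u j k * ((s j - s k) * V j k)) := by
  have h : ∀ i, ⁅V j k * (u j k * u j k), s i * d i⁆ = u j k * u j k * ⁅V j k, s i⁆ * d i +
      (2 * ((if i = j then (1 : ℂ) else 0) - (if i = k then (1 : ℂ) else 0))) •
        (u j k * u j k * u j k * (s i * V j k)) := by
    intro i
    have e1 : ⁅u j k * u j k, d i⁆ =
        (2 * ((if i = j then (1 : ℂ) else 0) - (if i = k then (1 : ℂ) else 0))) •
          (u j k * u j k * u j k) := by
      rw [← lie_skew, lie_mul_right, hu.lie_d_u, smul_mul_assoc, mul_smul_comm, ← mul_assoc]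
      module
    have c2 : Commute (u j k * u j k) ⁅V j k, s i⁆ :=
      (hV.u_lie j k j k i).mul_left (hV.u_lie j k j k i)
    have c3 : Commute (u j k * u j k * u j k) (s i * V j k) :=
      have c := (hV.u_s j k i).mul_right (hV.u_V j k j k)
      (c.mul_left c).mul_left c
    rw [lie_mul_right, lie_mul_left, lie_eq_zero_of_commute
      ((hV.u_s j k i).mul_left (hV.u_s j k i)), lie_mul_left, e1,
      lie_eq_zero_of_commute (hV.d_V i j k).symm, c2.eq, c3.eq, mul_zero, zero_add, zero_mul,
      add_zero, mul_smul_comm, mul_smul_comm, mul_assoc (s i)]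
  rw [lie_sum]
  simp only [h, Finset.sum_add_distrib]
  rw [hV.sum_lie hjk (fun l a => u j k * u j k * a * d l) (by simp)]
  congr 1
  · noncomm_ring
  · simp only [mul_sub, sub_smul, Finset.sum_sub_distrib, mul_ite, mul_one, mul_zero, ite_smul,
      zero_smul, Finset.sum_ite_eq', Finset.mem_univ, if_true, smul_sub, sub_mul]

/-- Inclusion and exclusion: only pairs meeting `{j, k}` contribute, and the pair `{j, k}` itself is
counted twice among them. -/
theorem sum_sum_eq_of_symm {j k : ι} (hjk : j ≠ k) (G : ι → ι → A) (hG : ∀ l i, G l i = G i l)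
    (h0 : ∀ l, G l l = 0) (hjk0 : ∀ l i, j ≠ l → k ≠ l → j ≠ i → k ≠ i → G l i = 0) :
    ∑ l, ∑ i, G l i = (2 : ℂ) • ∑ l, (G j l + G k l) - (2 : ℂ) • G j k := by
  have h : ∀ l i, G l i = (if l = j then G j i else 0) + (if l = k then G k i else 0) +
      (if i = j then G l j else 0) + (if i = k then G l k else 0) -
      (if l = j then if i = k then G j k else 0 else 0) -
      (if l = k then if i = j then G k j else 0 else 0) := by
    intro l i
    by_cases h1 : l = j
    · subst h1
      by_cases h2 : i = l
      · subst h2; simp [hjk, h0]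
      · by_cases h3 : i = k
        · subst h3; simp [hjk, h2]
        · simp [hjk, h2, h3]
    · by_cases h1' : l = k
      · subst h1'
        by_cases h2 : i = l
        · subst h2; simp [hjk.symm, h0]
        · by_cases h3 : i = j
          · subst h3; simp [h1, hjk]
          · simp [h1, h2, h3]
      · by_cases h2 : i = j
        · subst h2; simp [h1, h1', hjk]
        · by_cases h3 : i = k
          · subst h3; simp [h1, h1', h2]
          · simp [h1, h1', h2, h3, hjk0 l i (Ne.symm h1) (Ne.symm h1') (Ne.symm h2) (Ne.symm h3)]
  calc ∑ l, ∑ i, G l i = ∑ l, ∑ i, ((if l = j then G j i else 0) + (if l = k then G k i else 0) +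
      (if i = j then G l j else 0) + (if i = k then G l k else 0) -
      (if l = j then if i = k then G j k else 0 else 0) -
      (if l = k then if i = j then G k j else 0 else 0)) :=
        Finset.sum_congr rfl fun l _ => Finset.sum_congr rfl fun i _ => h l i
    _ = (∑ i, G j i + ∑ i, G k i + ∑ l, G l j + ∑ l, G l k) - G j k - G k j := by
        simp only [Finset.sum_sub_distrib, Finset.sum_add_distrib, Finset.sum_ite_eq',
          Finset.mem_univ, if_true]
        simp
    _ = _ := by
        rw [hG k j, Finset.sum_congr rfl fun l _ => hG l j, Finset.sum_congr rfl fun l _ => hG l k,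
          Finset.sum_add_distrib]
        module

/-- The contribution of a triple of particles to the commutator of the Hamiltonian with a
current. -/
def tripleTerm (u V : ι → ι → A) (s : ι → A) (j k l : ι) : A :=
  u j k * u j l * u k l * ⁅V j k, ⁅V k l, s k⁆⁆

/-- For distinct indices the product of the three `u` is cyclically invariant, and by the braid
relations so is `[V_{jk}, V_{kl}]`. The cyclic sum is thus a bracket with `s_j + s_k + s_l`, which
commutes with both interactions. -/
theorem tripleTerm_cyclic (hu : IsConfigOps x d u) (hV : IsPairInteraction x d u V s) (j k l : ι) :
    tripleTerm u V s j k l + tripleTerm u V s k l j + tripleTerm u V s l j k = 0 := by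
  have h : ∀ j k l, j ≠ k → j ≠ l → k ≠ l → tripleTerm u V s j k l =
      u j k * u k l * u l j * ⁅⁅V j k, V k l⁆, s l⁆ := by
    intro j k l hjk hjl hkl
    have h1 : ⁅V k l, s k⁆ = -⁅V k l, s l⁆ := by rw [hV.lie_swap hkl, neg_neg]
    rw [tripleTerm, h1, lie_neg, leibniz_lie,
      lie_eq_zero_of_commute (hV.V_s_ne j k l hjl hkl), lie_zero, add_zero, hu.u_swap j l,
      mul_assoc (u j k), (hu.u_u j l k l).eq]
    noncomm_ring
  have hb : ∀ j k l, j ≠ k → j ≠ l → k ≠ l → ⁅V k l, V l j⁆ = ⁅V j k, V k l⁆ := by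
    intro j k l hjk hjl hkl
    have h1 := lie_eq_zero_of_commute (hV.V_V_add k l j hkl hjk.symm hjl.symm)
    rw [lie_add] at h1
    rw [eq_neg_of_add_eq_zero_right h1, lie_skew, hV.V_symm j k hjk]
  by_cases hjk : j = k
  · subst hjk; simp [tripleTerm, hu.u_self]
  by_cases hjl : j = l
  · subst hjl; simp [tripleTerm, hu.u_self]
  by_cases hkl : k = l
  · subst hkl; simp [tripleTerm, hu.u_self]
  rw [h j k l hjk hjl hkl, h k l j hkl (Ne.symm hjk) (Ne.symm hjl),
    h l j k (Ne.symm hjl) (Ne.symm hkl) hjk, hb k l j hkl (Ne.symm hjk) (Ne.symm hjl),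
    hb j k l hjk hjl hkl]
  have e1 : u k l * u l j * u j k = u j k * u k l * u l j := by
    rw [((hu.u_u j k k l).mul_right (hu.u_u j k l j)).eq.symm, mul_assoc]
  have e2 : u l j * u j k * u k l = u j k * u k l * u l j := by
    rw [mul_assoc, ((hu.u_u l j j k).mul_right (hu.u_u l j k l)).eq]
  rw [e1, e2, ← mul_add, ← mul_add, ← lie_add, ← lie_add]
  have c1 : Commute (V j k) (s l + s j + s k) := by
    rw [add_assoc]
    exact (hV.V_s_ne j k l hjl hkl).add_right (hV.V_s_add j k hjk)
  have c2 : Commute (V k l) (s l + s j + s k) := by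
    rw [show s l + s j + s k = s k + s l + s j by abel]
    exact (hV.V_s_add k l hkl).add_right (hV.V_s_ne k l j (Ne.symm hjk) (Ne.symm hjl))
  rw [lie_eq_zero_of_commute (c1.symm.lie_right_of_ring c2.symm).symm, mul_zero]

theorem sum_tripleTerm (hu : IsConfigOps x d u) (hV : IsPairInteraction x d u V s) :
    ∑ j, ∑ k, ∑ l, tripleTerm u V s j k l = 0 := by
  have e1 : ∑ j, ∑ k, ∑ l, tripleTerm u V s k l j = ∑ j, ∑ k, ∑ l, tripleTerm u V s j k l := by
    rw [Finset.sum_comm]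
    exact Finset.sum_congr rfl fun k _ => Finset.sum_comm
  have e2 : ∑ j, ∑ k, ∑ l, tripleTerm u V s l j k = ∑ j, ∑ k, ∑ l, tripleTerm u V s j k l := by
    exact (Finset.sum_congr rfl fun j _ => Finset.sum_comm).trans Finset.sum_comm
  have h : (3 : ℂ) • ∑ j, ∑ k, ∑ l, tripleTerm u V s j k l = 0 := by
    calc (3 : ℂ) • ∑ j, ∑ k, ∑ l, tripleTerm u V s j k l =
        ∑ j, ∑ k, ∑ l, tripleTerm u V s j k l + ∑ j, ∑ k, ∑ l, tripleTerm u V s k l j +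
          ∑ j, ∑ k, ∑ l, tripleTerm u V s l j k := by rw [e1, e2]; module
      _ = 0 := by simp only [← Finset.sum_add_distrib, tripleTerm_cyclic hu hV,
          Finset.sum_const_zero]
  simpa using h

/-- Disjoint pairs commute. The pair `{j, k}` gives the double commutator; pairs sharing one
particle combine into triple terms. -/
theorem lie_pair_pairs (hu : IsConfigOps x d u) (hV : IsPairInteraction x d u V s) {j k : ι}
    (hjk : j ≠ k) :
    ⁅V j k * (u j k * u j k), ∑ l, ∑ i, u l i * ⁅V l i, s l⁆⁆ =
      (2 : ℂ) • (u j k * u j k * u j k * ⁅V j k, ⁅V j k, s j⁆⁆) +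
        (2 : ℂ) • ∑ l, tripleTerm u V s j k l := by
  have hW : ∀ l i, l ≠ i → ⁅V i l, s i⁆ = -⁅V l i, s l⁆ := fun l i hli => by
    rw [hV.V_symm l i hli, hV.lie_swap hli]
  have h : ∀ l i, ⁅V j k * (u j k * u j k), u l i * ⁅V l i, s l⁆⁆ =
      u j k * u j k * (u l i * ⁅V j k, ⁅V l i, s l⁆⁆) := fun l i => by
    rw [lie_mul_mul ((hV.u_V j k j k).mul_left (hV.u_V j k j k))
      ((hV.u_lie j k l i l).mul_left (hV.u_lie j k l i l)) (hV.u_V l i j k)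
      ((hu.u_u j k l i).mul_left (hu.u_u j k l i)), mul_assoc (u j k * u j k)]
  have hT : ∀ l, u j k * u j k * (u j l * ⁅V j k, ⁅V j l, s j⁆⁆ + u k l * ⁅V j k, ⁅V k l, s k⁆⁆) =
      tripleTerm u V s j k l +
        ((if l = j then u j k * u j k * (u j k * ⁅V j k, ⁅V j k, s j⁆⁆) else 0) +
        (if l = k then u j k * u j k * (u j k * ⁅V j k, ⁅V j k, s j⁆⁆) else 0)) := by
    intro l
    by_cases h1 : l = j
    · subst h1
      simp [tripleTerm, hu.u_self, hjk, hW l k hjk, hu.u_swap l k, -lie_skew]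
    by_cases h2 : l = k
    · subst h2
      simp [tripleTerm, hu.u_self, h1]
    have c : ⁅V j k, ⁅V j l, s j⁆⁆ = -⁅V j k, ⁅V k l, s k⁆⁆ := by
      have e : ∀ i, i ≠ l → ⁅V i l, s i⁆ = -⁅V i l, s l⁆ := fun i hi => by
        rw [hV.lie_swap hi, neg_neg]
      have c1 : Commute (V j k) ⁅V j l + V k l, s l⁆ :=
        (hV.V_V_add j k l hjk (Ne.symm h1) (Ne.symm h2)).lie_right_of_ring
          (hV.V_s_ne j k l (Ne.symm h1) (Ne.symm h2))
      have c2 := lie_eq_zero_of_commute c1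
      rw [add_lie, lie_add] at c2
      rw [e j (Ne.symm h1), e k (Ne.symm h2), lie_neg, lie_neg, neg_neg]
      exact neg_eq_of_add_eq_zero_right c2
    -- Partial fractions for the three differences.
    have e : u j k * (u k l - u j l) = u j l * u k l := by
      have a1 := hu.sub_mul_u j l (Ne.symm h1)
      have a2 := hu.sub_mul_u k l (Ne.symm h2)
      have a3 := hu.sub_mul_u j k hjk
      have b : u k l - u j l = (x j - x k) * (u j l * u k l) := by
        have : (x j - x k) * (u j l * u k l) =
            (x j - x l) * u j l * u k l - u j l * ((x k - x l) * u k l) := by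
          have cc : ∀ i, x i * (u j l * u k l) = u j l * (x i * u k l) := fun i => by
            rw [← mul_assoc, (hu.x_u i j l).eq, mul_assoc]
          simp only [sub_mul, mul_sub, mul_assoc, cc]
          abel
        rw [this, a1, a2]; simp
      have cu : Commute (x j - x k) (u j k) := (hu.x_u j j k).sub_left (hu.x_u k j k)
      rw [b, ← mul_assoc, ← cu.eq, a3, one_mul]
    rw [if_neg h1, if_neg h2, add_zero, add_zero, c, tripleTerm, mul_assoc (u j k) (u j l), ← e]
    noncomm_ring
  rw [lie_sum]
  simp only [lie_sum, h, ← Finset.mul_sum]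
  rw [sum_sum_eq_of_symm hjk (fun l i => u l i * ⁅V j k, ⁅V l i, s l⁆⁆), mul_sub, mul_smul_comm,
    Finset.mul_sum]
  · simp only [hT, Finset.sum_add_distrib, Finset.sum_ite_eq', Finset.mem_univ, if_true,
      mul_smul_comm, ← mul_assoc]
    module
  · intro l i
    by_cases hli : l = i
    · rw [hli]
    · simp only [hW l i hli, hu.u_swap l i, lie_neg, neg_mul_neg]
  · intro l
    simp [hu.u_self]
  · intro l i h1 h2 h3 h4
    rw [lie_eq_zero_of_commute ((hV.V_V_ne j k l i h1 h2 h3 h4).lie_right_of_ring (hV.V_s_ne j k l h1 h2)),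
      mul_zero]

theorem lie_hamiltonian_current (hu : IsConfigOps x d u) (hV : IsPairInteraction x d u V s)
    (h2 : ∀ j k, j ≠ k → (2 : ℂ) • ⁅V j k, s j⁆ + (2 : ℂ) • ((s j - s k) * V j k) +
      ⁅V j k, ⁅V j k, s j⁆⁆ = 0) :
    ⁅hamiltonian d u V, current d u V s⁆ = 0 := by
  have hdd : ⁅∑ i, d i * d i, ∑ i, s i * d i⁆ = 0 :=
    lie_eq_zero_of_commute <| Commute.sum_left _ _ _ fun i _ => Commute.sum_right _ _ _ fun k _ =>
      have c := (hV.d_s i k).mul_right (hu.d_d i k)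
      c.mul_left c
  have hK : ⁅∑ i, d i * d i, ∑ j, ∑ k, u j k * ⁅V j k, s j⁆⁆ =
      ∑ j, ∑ k, (∑ i, ⁅d i * d i, u j k⁆) * ⁅V j k, s j⁆ := by
    rw [lie_sum]
    refine Finset.sum_congr rfl fun j _ => ?_
    rw [lie_sum]
    refine Finset.sum_congr rfl fun k _ => ?_
    rw [lie_mul_right, sum_lie, lie_eq_zero_of_commute (a := ∑ i, d i * d i) (b := ⁅V j k, s j⁆),
      mul_zero, add_zero]
    exact Commute.sum_left _ _ _ fun i _ =>
      have c := (hV.d_V i j k).lie_right_of_ring (hV.d_s i j)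
      c.mul_left c
  rw [current, lie_add, lie_smul, hamiltonian, add_lie, add_lie, hdd, hK, zero_add, sum_lie,
    sum_lie]
  simp only [sum_lie]
  rw [Finset.smul_sum, ← Finset.sum_add_distrib, ← Finset.sum_add_distrib]
  -- The terms `u_{jk}² [V_{jk}, s_j] (∂_j - ∂_k)` from the kinetic and potential parts cancel. The
  -- `u_{jk}³` terms form `2 u_{jk}³` times the two-body identity `h2`, leaving the triple terms.
  have key : ∀ j k, (2 : ℂ) • ⁅V j k * (u j k * u j k), ∑ i, s i * d i⁆ +
      ((∑ i, ⁅d i * d i, u j k⁆) * ⁅V j k, s j⁆ +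
        ⁅V j k * (u j k * u j k), ∑ l, ∑ i, u l i * ⁅V l i, s l⁆⁆) =
      (2 : ℂ) • ∑ l, tripleTerm u V s j k l := by
    intro j k
    by_cases hjk : j = k
    · subst hjk
      simp [hu.u_self, tripleTerm]
    · have hd : Commute (d j - d k) ⁅V j k, s j⁆ :=
        ((hV.d_V j j k).lie_right_of_ring (hV.d_s j j)).sub_left ((hV.d_V k j k).lie_right_of_ring (hV.d_s k j))
      rw [lie_pair_kinetic hu hV hjk, hu.lie_d_sq_u hjk, lie_pair_pairs hu hV hjk]
      have h3 := congrArg (fun a => (2 : ℂ) • (u j k * u j k * u j k * a)) (h2 j k hjk)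
      simp only [mul_add, mul_zero, smul_zero, mul_smul_comm] at h3
      rw [mul_assoc (u j k * u j k) ⁅V j k, s j⁆, ← hd.eq, add_mul, smul_mul_assoc, smul_mul_assoc,
        mul_assoc (u j k * u j k) (d k - d j), ← neg_sub (d j) (d k), neg_mul, mul_neg]
      linear_combination (norm := module) h3
  simp only [Finset.smul_sum, ← Finset.sum_add_distrib, key]
  simp only [← Finset.smul_sum, sum_tripleTerm hu hV, smul_zero]

end Calogero

/-! ### Coordinates, derivatives and inverse differences on wave functions -/

section WaveOperators

variable {m n L : ℕ}

theorem wave_end_ext {A B : Module.End ℂ (Wave m n L)}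
    (h : ∀ ψ, ∀ x ∈ config L, (A ψ).1 x = (B ψ).1 x) : A = B := by
  refine LinearMap.ext fun ψ => Subtype.ext (funext fun x => ?_)
  by_cases hx : x ∈ config L
  · exact h ψ x hx
  · rw [(A ψ).2.2 x hx, (B ψ).2.2 x hx]

/-- Spin operators act on wave functions by an algebra homomorphism. -/
noncomputable def spinHom (m n L : ℕ) : (Spin m n L →ₗ[ℂ] Spin m n L) →ₐ[ℂ] Module.End ℂ (Wave m n L) :=
  AlgHom.ofLinearMap
    { toFun := spinOp m n L
      map_add' := fun _ _ => rfl
      map_smul' := fun _ _ => rfl } rfl fun _ _ => rfl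

theorem spinHom_apply (A : Spin m n L →ₗ[ℂ] Spin m n L) : spinHom m n L A = spinOp m n L A := rfl

/-- Multiplication of wave functions by the coordinate `x_j`. -/
noncomputable def coordOp (m n L : ℕ) (j : Fin L) : Module.End ℂ (Wave m n L) where
  toFun ψ := ⟨fun x => x j • ψ.1 x,
    (contDiff_apply ℝ ℝ j).contDiffOn.smul ψ.2.1, fun x hx => by simp [ψ.2.2 x hx]⟩
  map_add' ψ φ := by
    ext1
    funext x
    exact smul_add _ _ _
  map_smul' c ψ := by
    ext1
    funext x
    exact smul_comm (x j) c (ψ.1 x)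

theorem wave_differentiableAt (ψ : Wave m n L) {x : Fin L → ℝ} (hx : x ∈ config L) :
    DifferentiableAt ℝ ψ.1 x :=
  (ψ.2.1.contDiffAt ((isOpen_config L).mem_nhds hx)).differentiableAt (by simp)

theorem partialOp_apply (j : Fin L) (ψ : Wave m n L) {x : Fin L → ℝ} (hx : x ∈ config L) :
    (partialOp m n L j ψ).1 x = fderiv ℝ ψ.1 x (Pi.single j 1) :=
  Set.indicator_of_mem hx fun y => fderiv ℝ ψ.1 y (Pi.single j 1)

theorem commute_partialOp_spinOp (j : Fin L) (A : Spin m n L →ₗ[ℂ] Spin m n L) :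
    Commute (partialOp m n L j) (spinOp m n L A) := by
  refine wave_end_ext fun ψ x hx => ?_
  rw [Module.End.mul_apply, Module.End.mul_apply, partialOp_apply j _ hx]
  have h := ((LinearMap.toContinuousLinearMap (A.restrictScalars ℝ)).hasFDerivAt.comp x
    (wave_differentiableAt ψ hx).hasFDerivAt).fderiv
  change fderiv ℝ (LinearMap.toContinuousLinearMap (A.restrictScalars ℝ) ∘ ψ.1) x (Pi.single j 1) =
    A ((partialOp m n L j ψ).1 x)
  rw [h, partialOp_apply j _ hx]
  rfl

theorem commute_coordOp_spinOp (j : Fin L) (A : Spin m n L →ₗ[ℂ] Spin m n L) :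
    Commute (coordOp m n L j) (spinOp m n L A) := by
  refine wave_end_ext fun ψ x _ => ?_
  exact ((A.restrictScalars ℝ).map_smul (x j) (ψ.1 x)).symm

theorem commute_invDiffOp_spinOp (j k : Fin L) (A : Spin m n L →ₗ[ℂ] Spin m n L) :
    Commute (invDiffOp m n L j k) (spinOp m n L A) := by
  refine wave_end_ext fun ψ x _ => ?_
  exact ((A.restrictScalars ℝ).map_smul (1 / (x j - x k)) (ψ.1 x)).symm

theorem commute_partialOp (i j : Fin L) : Commute (partialOp m n L i) (partialOp m n L j) := by
  refine wave_end_ext fun ψ x hx => ?_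
  have h2 : ContDiffAt ℝ 2 ψ.1 x := (ψ.2.1.contDiffAt ((isOpen_config L).mem_nhds hx)).of_le
    (WithTop.coe_le_coe.2 (le_top : (2 : ℕ∞) ≤ ⊤))
  have hd : DifferentiableAt ℝ (fderiv ℝ ψ.1) x :=
    (h2.fderiv_right (m := 1) (by norm_num)).differentiableAt (by simp)
  have hs : IsSymmSndFDerivAt ℝ ψ.1 x := h2.isSymmSndFDerivAt (by simp)
  have key : ∀ k l : Fin L, (partialOp m n L k (partialOp m n L l ψ)).1 x =
      fderiv ℝ (fderiv ℝ ψ.1) x (Pi.single k 1) (Pi.single l 1) := by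
    intro k l
    rw [partialOp_apply k _ hx]
    -- The extension by zero does not affect derivatives at `x`, because the configuration space is
    -- open.
    have he : (partialOp m n L l ψ).1 =ᶠ[nhds x] fun y => fderiv ℝ ψ.1 y (Pi.single l 1) := by
      filter_upwards [(isOpen_config L).mem_nhds hx] with y hy using partialOp_apply l ψ hy
    rw [he.fderiv_eq, fderiv_clm_apply hd (differentiableAt_const _)]
    simp
  rw [Module.End.mul_apply, Module.End.mul_apply, key, key]
  exact hs _ _

theorem partialOp_smul_apply (i : Fin L) (ψ : Wave m n L) {x : Fin L → ℝ} (hx : x ∈ config L)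
    {c : (Fin L → ℝ) → ℝ} {c' : (Fin L → ℝ) →L[ℝ] ℝ} (hc : HasFDerivAt c c' x) (φ : Wave m n L)
    (hφ : ∀ y, φ.1 y = c y • ψ.1 y) :
    (partialOp m n L i φ).1 x =
      c x • (partialOp m n L i ψ).1 x + c' (Pi.single i 1) • ψ.1 x := by
  rw [partialOp_apply i _ hx, partialOp_apply i _ hx, show φ.1 = fun y => c y • ψ.1 y from funext hφ,
    (hc.fun_smul (wave_differentiableAt ψ hx).hasFDerivAt).fderiv]
  simp

theorem isConfigOps (m n L : ℕ) :
    IsConfigOps (coordOp m n L) (partialOp m n L) (invDiffOp m n L) where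
  d_d := commute_partialOp
  x_u i j k := wave_end_ext fun ψ x _ => smul_comm (x i) (1 / (x j - x k)) (ψ.1 x)
  x_x i j := wave_end_ext fun ψ x _ => smul_comm (x i) (x j) (ψ.1 x)
  u_u j k l i := wave_end_ext fun ψ x _ =>
    smul_comm (1 / (x j - x k)) (1 / (x l - x i)) (ψ.1 x)
  lie_d_x i j := by
    refine wave_end_ext fun ψ x hx => ?_
    have h := partialOp_smul_apply i ψ hx (hasFDerivAt_apply j x) (coordOp m n L j ψ) fun _ => rfl
    rw [Ring.lie_def]
    change (partialOp m n L i (coordOp m n L j ψ)).1 x - x j • (partialOp m n L i ψ).1 x = _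
    rw [h, add_sub_cancel_left]
    by_cases hij : i = j
    · subst hij; simp
    · simp [hij, Ne.symm hij]
  lie_d_u i j k := by
    refine wave_end_ext fun ψ x hx => ?_
    rw [Ring.lie_def]
    change (partialOp m n L i (invDiffOp m n L j k ψ)).1 x -
      (1 / (x j - x k)) • (partialOp m n L i ψ).1 x =
      (_ : ℂ) • ((1 / (x j - x k)) • (1 / (x j - x k)) • ψ.1 x)
    by_cases hjk : j = k
    · subst hjk
      -- On the diagonal, `1 / 0 = 0` supplies the convention `u_{jj} = 0`.
      have h0 : invDiffOp m n L j j ψ = 0 := Subtype.ext (funext fun y => by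
        change (1 / (y j - y j)) • ψ.1 y = 0; simp)
      simp [h0]
    · have hne : x j - x k ≠ 0 := sub_ne_zero.2 (hx j k hjk)
      have hc := (hasDerivAt_inv hne).comp_hasFDerivAt x
        ((hasFDerivAt_apply (𝕜 := ℝ) j x).sub (hasFDerivAt_apply k x))
      have h := partialOp_smul_apply i ψ hx hc (invDiffOp m n L j k ψ) fun y => by
        change (1 / (y j - y k)) • ψ.1 y = _
        simp
      rw [h]
      have e : ∀ a : ℂ, ∀ b : ℝ, a = b → ∀ v : Spin m n L, a • v = b • v := by
        rintro _ b rfl v; rfl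
      rw [e _ ((if i = k then (1 : ℝ) else 0) - (if i = j then (1 : ℝ) else 0))
        (by split_ifs <;> simp)]
      simp only [Function.comp_apply, Pi.sub_apply, one_div, add_sub_cancel_left, smul_smul]
      congr 1
      simp [Pi.single_apply, eq_comm (a := i), ← inv_pow]
      ring
  u_self j := wave_end_ext fun ψ x _ => by
    change (1 / (x j - x j)) • ψ.1 x = 0
    simp
  u_swap j k := wave_end_ext fun ψ x _ => by
    change (1 / (x k - x j)) • ψ.1 x = -((1 / (x j - x k)) • ψ.1 x)
    rw [← neg_smul, ← neg_sub (x j) (x k), div_neg]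
  sub_mul_u j k hjk := wave_end_ext fun ψ x hx => by
    change x j • (1 / (x j - x k)) • ψ.1 x - x k • (1 / (x j - x k)) • ψ.1 x = ψ.1 x
    rw [← sub_smul, smul_smul, mul_one_div_cancel (sub_ne_zero.2 (hx j k hjk)), one_smul]

end WaveOperators

/-! ### Derivations, the current-algebra realization, and the interaction `λΩ - λ²` -/

section Assembly

attribute [local instance] LieRing.ofAssociativeRing LieAlgebra.ofAssociativeAlgebra

section

variable {A : Type*} [Ring A] [Algebra ℂ A]

/-- The ordinary bracket with `H` is a derivation of the associative product, so parities bring no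
signs. -/
theorem lie_gradedComm (p q : ℕ) (H X Y : A) :
    ⁅H, gradedComm p q X Y⁆ = gradedComm p q ⁅H, X⁆ Y + gradedComm p q X ⁅H, Y⁆ := by
  simp only [gradedComm, lie_sub, lie_smul, lie_mul_right, smul_add]
  abel

/-- Of the second-order Leibniz expansion only the mixed term survives: its coefficient 2 times the
two factors 2 gives 8. -/
theorem lie_lie_gradedComm (p q : ℕ) {H X Y X' Y' : A} (hX : ⁅H, X⁆ = (2 : ℂ) • X')
    (hY : ⁅H, Y⁆ = (2 : ℂ) • Y') (hX' : ⁅H, X'⁆ = 0) (hY' : ⁅H, Y'⁆ = 0) :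
    ⁅H, ⁅H, gradedComm p q X Y⁆⁆ = (8 : ℂ) • gradedComm p q X' Y' := by
  simp only [lie_gradedComm, hX, hY, gradedComm_smul_left, gradedComm_smul_right, lie_add,
    lie_smul, hX', hY', gradedComm_zero_left, gradedComm_zero_right]
  module

theorem gradedComm_sum_mul_sum {ι : Type*} [Fintype ι] (p q : ℕ) {x y a b : ι → A}
    (hxb : ∀ i j, Commute (x i) (b j)) (hya : ∀ i j, Commute (y i) (a j))
    (hxy : ∀ i j, Commute (x i) (y j)) (hab : ∀ i j, i ≠ j → gradedComm p q (a i) (b j) = 0) :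
    gradedComm p q (∑ i, x i * a i) (∑ i, y i * b i) =
      ∑ i, x i * y i * gradedComm p q (a i) (b i) := by
  classical
  rw [gradedComm_sum_left]
  refine Finset.sum_congr rfl fun i _ => ?_
  rw [gradedComm_sum_right, Finset.sum_eq_single i]
  · exact gradedComm_mul_mul p q (hxb i i) (hya i i) (hxy i i)
  · intro j _ hj
    rw [gradedComm_mul_mul p q (hxb i j) (hya j i) (hxy i j), hab i j hj.symm, mul_zero]
  · simp

theorem Commute.gradedComm_right {x X Y : A} (p q : ℕ) (hX : Commute x X) (hY : Commute x Y) :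
    Commute x (gradedComm p q X Y) :=
  (hX.mul_right hY).sub_right ((hY.mul_right hX).smul_right _)

theorem gradedComm_gradedComm_eq_zero (p q r : ℕ) {X Y Z : A} (hY : gradedComm p q X Y = 0)
    (hZ : gradedComm p r X Z = 0) : gradedComm p (q + r) X (gradedComm q r Y Z) = 0 := by
  rw [gradedComm_jacobi, hY, hZ, gradedComm_zero_left, gradedComm_zero_right, smul_zero, add_zero]

/-- The Serre-type relation for `∑ s_i` and `∑ x_i s_i`. -/
theorem gradedComm_moment_serre {ι : Type*} [Fintype ι] (p q r : ℕ) {x a b c : ι → A}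
    (hxx : ∀ i j, Commute (x i) (x j)) (hxa : ∀ i j, Commute (x i) (a j))
    (hxb : ∀ i j, Commute (x i) (b j)) (hxc : ∀ i j, Commute (x i) (c j))
    (hab : ∀ i j, i ≠ j → gradedComm p q (a i) (b j) = 0)
    (hac : ∀ i j, i ≠ j → gradedComm p r (a i) (c j) = 0)
    (hbc : ∀ i j, i ≠ j → gradedComm q r (b i) (c j) = 0) :
    (-1 : ℂ) ^ (p * q) • gradedComm q (p + r) (∑ i, x i * b i)
        (gradedComm p r (∑ i, a i) (∑ i, x i * c i)) +
      gradedComm (p + q) r (gradedComm p q (∑ i, a i) (∑ i, x i * b i)) (∑ i, x i * c i) -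
      gradedComm p (q + r) (∑ i, x i * a i) (gradedComm q r (∑ i, b i) (∑ i, x i * c i)) = 0 := by
  have hbc' : ∀ i, ∀ j, i ≠ j → gradedComm p (q + r) (a i) (gradedComm q r (b j) (c j)) = 0 :=
    fun i j hij => gradedComm_gradedComm_eq_zero p q r (hab i j hij) (hac i j hij)
  have hx1 : ∀ i j, Commute (x i) (gradedComm q r (b j) (c j)) := fun i j =>
    Commute.gradedComm_right q r (hxb i j) (hxc i j)
  have one_a := gradedComm_sum_mul_sum p (q + r) (x := fun _ => 1) (y := fun i => x i * x i) (a := a)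
    (b := fun i => gradedComm q r (b i) (c i)) (fun _ _ => Commute.one_left _)
    (fun i j => (hxa i j).mul_left (hxa i j)) (fun _ _ => Commute.one_left _) hbc'
  have one_b := gradedComm_sum_mul_sum q r (x := fun _ => 1) (y := x) (a := b) (b := c)
    (fun _ _ => Commute.one_left _) hxb (fun _ _ => Commute.one_left _) hbc
  simp only [one_mul] at one_a one_b
  -- By the Jacobi identity the first two terms are `[∑ a, [∑ x b, ∑ x c]]`. Both this and the third
  -- term equal `∑ x_i² [a_i, [b_i, c_i]]`.
  rw [← gradedComm_jacobi, gradedComm_sum_mul_sum q r hxc hxb hxx hbc, one_b, one_a,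
    gradedComm_sum_mul_sum p (q + r) hx1 hxa hxx hbc', sub_self]

end

section

variable {R ι : Type*} [Ring R] [Algebra ℂ R] {m n : ℕ}
  {e : ι → Fin (m + n) → Fin (m + n) → R}

theorem commute_casimirOp {y : R} (hy : ∀ j a b, Commute y (e j a b)) (j k : ι) :
    Commute y (casimirOp e j k) :=
  Commute.sum_right _ _ _ fun _ _ => Commute.sum_right _ _ _ fun _ _ =>
    ((commute_ospGen (hy j) _ _).mul_right (commute_lowered (hy k) _ _)).smul_right _

/-- The pair interaction `λ Ω_{jk} - λ²`. -/
def pairInteraction (e : ι → Fin (m + n) → Fin (m + n) → R) (lam : ℂ) (j k : ι) : R :=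
  lam • casimirOp e j k - (lam * lam) • (1 : R)

theorem Commute.pairInteraction_right {y : R} {lam : ℂ} {j k : ι}
    (hy : Commute y (casimirOp e j k)) : Commute y (pairInteraction e lam j k) :=
  (hy.smul_right _).sub_right ((Commute.one_right y).smul_right _)

variable [Fintype ι] [DecidableEq ι] {x d : ι → R} {u : ι → ι → R}

theorem IsGradedUnits.isPairInteraction (h : IsGradedUnits m n e) (hn : Even n)
    (hx : ∀ i j a b, Commute (x i) (e j a b)) (hd : ∀ i j a b, Commute (d i) (e j a b))
    (hu : ∀ i k j a b, Commute (u i k) (e j a b)) (lam : ℂ) (a b : Fin (m + n)) :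
    IsPairInteraction x d u (pairInteraction e lam) fun j => ospGen e j a b where
  x_V i j k := Commute.pairInteraction_right (commute_casimirOp (hx i) j k)
  d_V i j k := Commute.pairInteraction_right (commute_casimirOp (hd i) j k)
  u_V i l j k := Commute.pairInteraction_right (commute_casimirOp (hu i l) j k)
  x_s i j := commute_ospGen (hx i j) a b
  d_s i j := commute_ospGen (hd i j) a b
  u_s i l j := commute_ospGen (hu i l j) a b
  V_symm j k hjk := by rw [pairInteraction, pairInteraction, h.casimir_symm hn hjk]
  V_s_ne j k l hjl hkl :=
    (Commute.pairInteraction_right (commute_ospGen (h.casimir_comm hn hjl hkl) a b).symm).symm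
  V_s_add j k hjk :=
    (Commute.pairInteraction_right (h.casimir_comm_gen_add hn hjk a b).symm).symm
  V_V_ne j k l i hjl hkl hji hki := Commute.pairInteraction_right
    (Commute.pairInteraction_right (h.casimir_comm_casimir hn hjl hkl hji hki).symm).symm
  V_V_add j k l hjk hjl hkl := by
    have c := h.casimir_braid hn hjk hjl hkl
    refine (Commute.pairInteraction_right ?_).symm
    have c' : Commute (casimirOp e j k) (lam • (casimirOp e j l + casimirOp e k l) -
      (2 * (lam * lam)) • (1 : R)) :=
      (c.smul_right _).sub_right ((Commute.one_right _).smul_right _)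
    convert c'.symm using 1
    rw [pairInteraction, pairInteraction]
    module

/-- Antisymmetry of `u_{jk}` turns `-(σ_k σ_j)` into the first term with `j` and `k` exchanged, so
the double sum over ordered pairs yields the factor 2. -/
theorem IsGradedUnits.current_eq (h : IsGradedUnits m n e) (hn : Even n)
    (huc : IsConfigOps x d u) (hu : ∀ i k j a b, Commute (u i k) (e j a b)) (lam : ℂ)
    (a b : Fin (m + n)) :
    current d u (pairInteraction e lam) (fun j => ospGen e j a b) = (2 : ℂ) •
      (∑ j, ospGen e j a b * d j -
        lam • ∑ j, ∑ k ∈ Finset.univ.filter (· ≠ j), ospGenMul e j k a b * u j k) := by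
  have h1 : ∀ j k, u j k * ⁅pairInteraction e lam j k, ospGen e j a b⁆ =
      (-lam) • (u j k * ospGenMul e j k a b + u k j * ospGenMul e k j a b) := by
    intro j k
    by_cases hjk : j = k
    · subst hjk; simp [huc.u_self]
    · have h2 := h.gen_comm_casimir hn hjk a b
      have h3 : ⁅pairInteraction e lam j k, ospGen e j a b⁆ =
          (-lam) • (ospGenMul e j k a b - ospGenMul e k j a b) := by
        rw [← h2, Ring.lie_def, pairInteraction, sub_mul, mul_sub, smul_mul_assoc, mul_smul_comm,
          smul_mul_assoc, mul_smul_comm, one_mul, mul_one]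
        module
      rw [h3, mul_smul_comm, mul_sub, huc.u_swap j k, neg_mul, ← sub_eq_add_neg]
  have h2 : ∀ j k, Commute (u j k) (ospGenMul e j k a b) := fun j k =>
    Commute.sum_right _ _ _ fun _ _ => ((commute_ospGen (hu j k j) _ _).mul_right
      (commute_ospGen (hu j k k) _ _)).smul_right _
  have h3 : ∀ j, ∑ k ∈ Finset.univ.filter (· ≠ j), ospGenMul e j k a b * u j k =
      ∑ k, u j k * ospGenMul e j k a b := by
    intro j
    rw [Finset.sum_filter]
    refine Finset.sum_congr rfl fun k _ => ?_
    by_cases hk : k = j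
    · subst hk; simp [huc.u_self]
    · rw [if_pos hk, (h2 j k).eq]
  simp only [current, h1, h3, ← Finset.smul_sum, Finset.sum_add_distrib]
  rw [Finset.sum_comm (f := fun j k => u k j * ospGenMul e k j a b)]
  module

end

end Assembly

/-! ### Transfer of the relations to `J0` and `J1` by `ad H` -/

section CurrentAlgebra

attribute [local instance] LieRing.ofAssociativeRing LieAlgebra.ofAssociativeAlgebra

variable {R ι : Type*} [Ring R] [Algebra ℂ R] [Fintype ι] [DecidableEq ι] {m n : ℕ}
  {e : ι → Fin (m + n) → Fin (m + n) → R} {x d : ι → R} {u : ι → ι → R}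

/-- `∑_j y_j σ_j^{ab}`. -/
def moment (e : ι → Fin (m + n) → Fin (m + n) → R) (y : ι → R) (a b : Fin (m + n)) : R :=
  ∑ j, y j * ospGen e j a b

/-- `∑_j σ_j^{ab}`. -/
def totalGen (e : ι → Fin (m + n) → Fin (m + n) → R) (a b : Fin (m + n)) : R :=
  ∑ j, ospGen e j a b

/-- `∑_j σ_j^{ab} ∂_j - λ ∑_{j ≠ k} (σ_j σ_k)^{ab} u_{jk}`. -/
def dynGen (e : ι → Fin (m + n) → Fin (m + n) → R) (d : ι → R) (u : ι → ι → R) (lam : ℂ)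
    (a b : Fin (m + n)) : R :=
  ∑ j, ospGen e j a b * d j -
    lam • ∑ j, ∑ k ∈ Finset.univ.filter (· ≠ j), ospGenMul e j k a b * u j k

/-- Matrix units together with configuration operators that commute with them. -/
structure IsSpinConfig (e : ι → Fin (m + n) → Fin (m + n) → R) (x d : ι → R) (u : ι → ι → R) :
    Prop where
  units : IsGradedUnits m n e
  config : IsConfigOps x d u
  x_e : ∀ i j a b, Commute (x i) (e j a b)
  d_e : ∀ i j a b, Commute (d i) (e j a b)
  u_e : ∀ i k j a b, Commute (u i k) (e j a b)

theorem IsSpinConfig.lie_totalGen (h : IsSpinConfig e x d u) (hn : Even n) (lam : ℂ)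
    (a b : Fin (m + n)) : ⁅hamiltonian d u (pairInteraction e lam), totalGen e a b⁆ = 0 :=
  lie_hamiltonian_sum h.config (h.units.isPairInteraction hn h.x_e h.d_e h.u_e lam a b)

theorem IsSpinConfig.lie_moment (h : IsSpinConfig e x d u) (hn : Even n) (lam : ℂ)
    (a b : Fin (m + n)) : ⁅hamiltonian d u (pairInteraction e lam), moment e x a b⁆ =
      (2 : ℂ) • dynGen e d u lam a b := by
  rw [dynGen, ← h.units.current_eq hn h.config h.u_e]
  exact lie_hamiltonian_moment h.config (h.units.isPairInteraction hn h.x_e h.d_e h.u_e lam a b)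

/-- Of the three actions of `ad H`, on `totalGen`, `moment` and `dynGen`, this alone needs the
special value of `λ`. -/
theorem IsSpinConfig.lie_dynGen (h : IsSpinConfig e x d u) (hn : Even n) {lam : ℂ}
    (hlam : lam * ((m : ℂ) - n - 4) = 2) (a b : Fin (m + n)) :
    ⁅hamiltonian d u (pairInteraction e lam), dynGen e d u lam a b⁆ = 0 := by
  have h1 := lie_hamiltonian_current h.config
    (h.units.isPairInteraction hn h.x_e h.d_e h.u_e lam a b) fun j k hjk => by
      simp only [Ring.lie_def]
      exact h.units.two_body hn hlam hjk a b rfl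
  rw [h.units.current_eq hn h.config h.u_e, lie_smul] at h1
  simpa [dynGen] using h1

theorem IsGradedUnits.gradedComm_totalGen_moment (h : IsGradedUnits m n e) (hn : Even n)
    {y : ι → R} (hy : ∀ i j a b, Commute (y i) (e j a b)) (a b c d : Fin (m + n)) :
    gradedComm (par m n a b) (par m n c d) (totalGen e a b) (moment e y c d) =
        metric m n c b • moment e y a d
          - (-1 : ℂ) ^ (par m n a b * par m n c d) • metric m n a d • moment e y c b
          - (-1 : ℂ) ^ (grade m n c * grade m n d) •
            (metric m n d b • moment e y a c
              - (-1 : ℂ) ^ (par m n a b * par m n c d) • metric m n a c • moment e y d b) := by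
  have h1 := gradedComm_sum_mul_sum (par m n a b) (par m n c d) (x := fun _ => 1) (y := y)
    (a := fun j => ospGen e j a b) (b := fun j => ospGen e j c d)
    (fun _ _ => Commute.one_left _) (fun i j => commute_ospGen (hy i j) a b)
    (fun _ _ => Commute.one_left _) fun i j hij => h.gradedComm_gen_ne hij a b c d
  simp only [one_mul] at h1
  simp only [totalGen, moment, h1, h.gradedComm_gen_same hn, mul_sub, mul_smul_comm,
    Finset.sum_sub_distrib, Finset.smul_sum, smul_sub]

theorem IsGradedUnits.gradedComm_totalGen_totalGen (h : IsGradedUnits m n e) (hn : Even n)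
    (a b c d : Fin (m + n)) :
    gradedComm (par m n a b) (par m n c d) (totalGen e a b) (totalGen e c d) =
        metric m n c b • totalGen e a d
          - (-1 : ℂ) ^ (par m n a b * par m n c d) • metric m n a d • totalGen e c b
          - (-1 : ℂ) ^ (grade m n c * grade m n d) •
            (metric m n d b • totalGen e a c
              - (-1 : ℂ) ^ (par m n a b * par m n c d) • metric m n a c • totalGen e d b) := by
  have h1 : ∀ a b, totalGen e a b = moment e (fun _ => 1) a b := fun a b => by
    simp [totalGen, moment]
  rw [h1 c d, h.gradedComm_totalGen_moment hn fun _ _ _ _ => Commute.one_left _]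
  simp only [h1]

/-- `ad H` is applied to the same relation for `moment`; both sides acquire a factor 2. -/
theorem IsSpinConfig.gradedComm_totalGen_dynGen (h : IsSpinConfig e x d u) (hn : Even n) (lam : ℂ)
    (a b c f : Fin (m + n)) :
    gradedComm (par m n a b) (par m n c f) (totalGen e a b) (dynGen e d u lam c f) =
        metric m n c b • dynGen e d u lam a f
          - (-1 : ℂ) ^ (par m n a b * par m n c f) • metric m n a f • dynGen e d u lam c b
          - (-1 : ℂ) ^ (grade m n c * grade m n f) •
            (metric m n f b • dynGen e d u lam a c
              - (-1 : ℂ) ^ (par m n a b * par m n c f) • metric m n a c •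
                dynGen e d u lam f b) := by
  have h1 := congrArg (fun X => ⁅hamiltonian d u (pairInteraction e lam), X⁆)
    (h.units.gradedComm_totalGen_moment hn h.x_e a b c f)
  simp only [lie_gradedComm, h.lie_totalGen hn, gradedComm_zero_left, zero_add, lie_sub, lie_smul,
    h.lie_moment hn, gradedComm_smul_right] at h1
  refine smul_right_injective _ (two_ne_zero (α := ℂ)) ?_
  simp only [h1]
  module

theorem IsSpinConfig.dynGen_serre (h : IsSpinConfig e x d u) (hn : Even n) {lam : ℂ}
    (hlam : lam * ((m : ℂ) - n - 4) = 2) (a b c f i l : Fin (m + n)) :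
    (-1 : ℂ) ^ (par m n a b * par m n c f) •
          gradedComm (par m n c f) (par m n a b + par m n i l) (dynGen e d u lam c f)
            (gradedComm (par m n a b) (par m n i l) (totalGen e a b) (dynGen e d u lam i l))
        + gradedComm (par m n a b + par m n c f) (par m n i l)
            (gradedComm (par m n a b) (par m n c f) (totalGen e a b) (dynGen e d u lam c f))
            (dynGen e d u lam i l)
        - gradedComm (par m n a b) (par m n c f + par m n i l) (dynGen e d u lam a b)
            (gradedComm (par m n c f) (par m n i l) (totalGen e c f) (dynGen e d u lam i l)) = 0 := by
  have hx : ∀ a b, ∀ i j, Commute (x i) (ospGen e j a b) :=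
    fun a b i j => commute_ospGen (h.x_e i j) a b
  have hs := gradedComm_moment_serre (par m n a b) (par m n c f) (par m n i l)
    h.config.x_x (hx a b) (hx c f) (hx i l)
    (fun j k hjk => h.units.gradedComm_gen_ne hjk a b c f)
    (fun j k hjk => h.units.gradedComm_gen_ne hjk a b i l)
    (fun j k hjk => h.units.gradedComm_gen_ne hjk c f i l)
  simp only [← moment.eq_def, ← totalGen.eq_def] at hs
  have hD := h.lie_moment hn lam
  have hJ := h.lie_dynGen hn hlam
  have hTD : ∀ p q a b c f, ⁅hamiltonian d u (pairInteraction e lam),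
      gradedComm p q (totalGen e a b) (moment e x c f)⁆ =
        (2 : ℂ) • gradedComm p q (totalGen e a b) (dynGen e d u lam c f) := fun p q a b c f => by
    rw [lie_gradedComm, h.lie_totalGen hn, hD, gradedComm_zero_left, zero_add,
      gradedComm_smul_right]
  have hTJ : ∀ p q a b c f, ⁅hamiltonian d u (pairInteraction e lam),
      gradedComm p q (totalGen e a b) (dynGen e d u lam c f)⁆ = 0 := fun p q a b c f => by
    rw [lie_gradedComm, h.lie_totalGen hn, hJ, gradedComm_zero_left,
      gradedComm_zero_right, add_zero]
  -- Each inner bracket with `totalGen` behaves like `moment`: `ad H` sends it to twice its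
  -- counterpart with `dynGen`, and then to 0. So `lie_lie_gradedComm` applies to all three outer
  -- brackets, with common factor 8.
  have h8 := congrArg (fun X => ⁅hamiltonian d u (pairInteraction e lam),
    ⁅hamiltonian d u (pairInteraction e lam), X⁆⁆) hs
  simp only [lie_add, lie_sub, lie_smul, lie_zero] at h8
  rw [lie_lie_gradedComm _ _ (hD c f) (hTD _ _ a b i l) (hJ c f) (hTJ _ _ a b i l),
    lie_lie_gradedComm _ _ (hTD _ _ a b c f) (hD i l) (hTJ _ _ a b c f) (hJ i l),
    lie_lie_gradedComm _ _ (hD a b) (hTD _ _ c f i l) (hJ a b) (hTJ _ _ c f i l),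
    smul_comm, ← smul_add, ← smul_sub] at h8
  simpa using h8

end CurrentAlgebra

/-! ### Specialization to the operators on wave functions -/

section Assembly

/-- The matrix units acting on wave functions. -/
noncomputable def waveE (m n L : ℕ) (j : Fin L) (a b : Fin (m + n)) :
    Module.End ℂ (Wave m n L) :=
  spinHom m n L (siteE m n L j a b)

theorem wave_isSpinConfig (m n L : ℕ) :
    IsSpinConfig (waveE m n L) (coordOp m n L) (partialOp m n L) (invDiffOp m n L) where
  units := IsGradedUnits.map (S := Module.End ℂ (Wave m n L)) (siteE_isGradedUnits m n L)
    (spinHom m n L)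
  config := isConfigOps m n L
  x_e i _ _ _ := commute_coordOp_spinOp i _
  d_e i _ _ _ := commute_partialOp_spinOp i _
  u_e i k _ _ _ := commute_invDiffOp_spinOp i k _

theorem sigma_eq (m n L : ℕ) (j : Fin L) (a b : Fin (m + n)) :
    sigma m n L j a b = ospGen (siteE m n L) j a b := by
  rw [sigma, sum_metric_right a fun k => siteE m n L j k b,
    sum_metric_right b fun k => siteE m n L j k a]
  rfl

theorem spinHom_sigma (m n L : ℕ) (j : Fin L) (a b : Fin (m + n)) :
    spinHom m n L (sigma m n L j a b) = ospGen (waveE m n L) j a b := by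
  rw [sigma_eq]
  simp only [ospGen, lowered, map_sub, map_smul, waveE]

theorem spinHom_sigmaSigma (m n L : ℕ) (j k : Fin L) (a b : Fin (m + n)) :
    spinHom m n L (sigmaSigma m n L j k a b) = ospGenMul (waveE m n L) j k a b := by
  simp only [sigmaSigma, ospGenMul, map_sum, map_smul, ← spinHom_sigma, ← map_mul]
  rfl

theorem J0_eq (m n L : ℕ) (a b : Fin (m + n)) :
    J0 m n L a b = totalGen (waveE m n L) a b := by
  simp only [J0, totalGen, ← spinHom_apply, spinHom_sigma]

theorem J1_eq (m n L : ℕ) (lam : ℂ) (a b : Fin (m + n)) :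
    J1 m n L lam a b = dynGen (waveE m n L) (partialOp m n L) (invDiffOp m n L) lam a b := by
  simp only [J1, dynGen, ← spinHom_apply, spinHom_sigma, spinHom_sigmaSigma]

end Assembly

end OspCalogero

open OspCalogero

theorem proposition1 (m n L : ℕ) (hn : Even n) (hmn : (m : ℤ) - n - 4 ≠ 0)
    (lam : ℂ) (hlam : lam = 2 / ((m : ℂ) - n - 4)) :
    (∀ a b c d : Fin (m + n),
      gradedComm (par m n a b) (par m n c d) (J0 m n L a b) (J0 m n L c d) =
        metric m n c b • J0 m n L a d
          - (-1 : ℂ) ^ (par m n a b * par m n c d) • metric m n a d • J0 m n L c b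
          - (-1 : ℂ) ^ (grade m n c * grade m n d) •
            (metric m n d b • J0 m n L a c
              - (-1 : ℂ) ^ (par m n a b * par m n c d) • metric m n a c • J0 m n L d b)) ∧
    (∀ a b c d : Fin (m + n),
      gradedComm (par m n a b) (par m n c d) (J0 m n L a b) (J1 m n L lam c d) =
        metric m n c b • J1 m n L lam a d
          - (-1 : ℂ) ^ (par m n a b * par m n c d) • metric m n a d • J1 m n L lam c b
          - (-1 : ℂ) ^ (grade m n c * grade m n d) •
            (metric m n d b • J1 m n L lam a c
              - (-1 : ℂ) ^ (par m n a b * par m n c d) • metric m n a c • J1 m n L lam d b)) ∧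
    (∀ a b c d e f : Fin (m + n),
      (-1 : ℂ) ^ (par m n a b * par m n c d) •
          gradedComm (par m n c d) (par m n a b + par m n e f) (J1 m n L lam c d)
            (gradedComm (par m n a b) (par m n e f) (J0 m n L a b) (J1 m n L lam e f))
        + gradedComm (par m n a b + par m n c d) (par m n e f)
            (gradedComm (par m n a b) (par m n c d) (J0 m n L a b) (J1 m n L lam c d))
            (J1 m n L lam e f)
        - gradedComm (par m n a b) (par m n c d + par m n e f) (J1 m n L lam a b)
            (gradedComm (par m n c d) (par m n e f) (J0 m n L c d) (J1 m n L lam e f)) = 0) := by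
  have hne : (m : ℂ) - n - 4 ≠ 0 := by exact_mod_cast hmn
  have hl : lam * ((m : ℂ) - n - 4) = 2 := by rw [hlam, div_mul_cancel₀ _ hne]
  have h := wave_isSpinConfig m n L
  simp only [J0_eq, J1_eq]
  exact ⟨fun a b c d => h.units.gradedComm_totalGen_totalGen hn a b c d,
    fun a b c d => h.gradedComm_totalGen_dynGen hn lam a b c d,
    fun a b c d e f => h.dynGen_serre hn hl a b c d e f⟩
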